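/- Let ${\rm Dec}$ be a set of decorations; each $c\in{\rm Dec}$ carries an integer degree $|c|\ge 1$ and a constant $f_c\in\mathbb C$. Let $H$ be the Hopf algebra over $\mathbb C$ of non-planar rooted trees with vertices decorated by ${\rm Dec}$: the free commutative algebra on the trees (forests are the monomials, $e$ is the empty forest), with $\Delta(T)=T\otimes e+e\otimes T+\sum_C P^C(T)\otimes R^C(T)$, the sum running over the non-empty admissible cuts $C$ of the tree $T$, $P^C(T)$ being the pruned forest and $R^C(T)$ the trunk. Let $P$ be the projection of $H$ onto its augmentation ideal (along $\mathbb C e$), and let $B_+^c(X)$ be the tree obtained by joining the roots of the forest $X$ to a new root decorated by $c$. Fix $\mu^2>0$. Let $V$ be the ring of functions of $q^2>0$ with values in the Laurent series $\mathbb C((z))$ (poles of finite order). The toy Feynman rules are the character $\phi:H\to V$ which is multiplicative and given on trees recursively, in dimension $D=2-2z$, by $$\phi(B_+^c(X))\{q^2;z\}=[\mu^2]^{z|c|/2}\int \frac{f_c\,\phi(X)\{y^2;z\}}{y^2+q^2}\,[y^2]^{-z(|c|/2-1)}\,d^Dy ,$$ computed for small $z>0$, where the integrals converge, and expanded in a Laurent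 series at $z=0$. Let $R:V\to V$ be a $\mathbb C$-linear Rota–Baxter map, $R[ab]+R[a]R[b]=R[R[a]b]+R[aR[b]]$, such that (a) at $q^2=\mu^2$ the limit $\lim_{z\to0}(\phi(X)-R[\phi(X)])$ exists for all $X\in H$; (b) $R$ introduces no momentum dependence: it maps a Laurent series which does not depend on $q^2$ to a Laurent series which does not depend on $q^2$, and it maps an element of $V$ which has a limit as $z\to0$ for every $q^2$ to a Laurent series which does not depend on $q^2$ and has a limit as $z\to0$. (Minimal subtraction and subtraction at $q^2=\mu^2$ satisfy these conditions.) Let $S_R^\phi:H\to V$ be the character with $S_R^\phi(T)=-R[\bar\phi_R(T)]$ for every tree $T$, where $\bar\phi_R=m_V\circ(S_R^\phi\otimes\phi)\circ({\rm id}\otimes P)\circ\Delta$, and let $\phi_R=S_R^\phi*\phi=m_V\circ(S_R^\phi\otimes\phi)\circ\Delta$. **Theorem.** For every decorated rooted tree $T$: i) (finiteness) for every $q^2>0$ the limit $\lim_{z\to0}\phi_R(T)\{q^2;z\}$ exists, and it is a polynomial in $\log(q^2/\mu^2)$; ii) (local counterterms) $\partial\bar\phi_R(T)/\partial\log(q^2/\mu^2)$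 exists (coefficientwise in $z$), and $\lim_{z\to0}\partial\bar\phi_R(T)/\partial\log(q^2/\mu^2)$ exists for every $q^2>0$. -/

import Mathlib

open Filter Topology MeasureTheory
open scoped TensorProduct LaurentSeries

noncomputable section

universe u

/-! ### Non-planar rooted trees with decorated vertices -/

/-- The functor `X ↦ Dec × Multiset X`: a root decoration and an unordered collection (with
multiplicities) of branches. -/
def TreeShape (Dec : Type u) (X : Type u) : Type u := Dec × Multiset X

instance TreeShape.instQPF (Dec : Type u) : QPF (TreeShape Dec) where
  map g x := (x.1, x.2.map g)
  P := ⟨Dec × ℕ, fun a => ULift (Fin a.2)⟩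
  abs x := (x.1.1, (List.ofFn fun i => x.2 ⟨i⟩ : List _))
  repr x := ⟨(x.1, x.2.toList.length), fun i => x.2.toList.get i.down⟩
  abs_repr x := by
    refine Prod.ext rfl ?_
    change ((List.ofFn x.2.toList.get : List _) : Multiset _) = x.2
    rw [List.ofFn_get, Multiset.coe_toList]
  abs_map g p := by
    refine Prod.ext rfl ?_
    change (((List.ofFn fun i => g (p.2 ⟨i⟩)) : List _) : Multiset _) =
      Multiset.map g ((List.ofFn fun i => p.2 ⟨i⟩ : List _) : Multiset _)
    rw [Multiset.map_coe, List.map_ofFn]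
    rfl

/-- Finite non-planar rooted trees whose vertices are decorated by `Dec`: the initial algebra of
`X ↦ Dec × Multiset X`. -/
def RTree (Dec : Type u) : Type u := QPF.Fix (TreeShape Dec)

namespace RTree

variable {Dec : Type u}

/-- `node c ts` is the tree `B_+^c(∏ ts)`: the roots of the trees in `ts` are joined to a new
root decorated by `c`. -/
def node (c : Dec) (ts : Multiset (RTree Dec)) : RTree Dec :=
  QPF.Fix.mk (F := TreeShape Dec) (c, ts)

/-- The decoration of the root. -/
def dec (T : RTree Dec) : Dec := (QPF.Fix.dest (F := TreeShape Dec) T).1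

/-- The branches at the root. -/
def children (T : RTree Dec) : Multiset (RTree Dec) := (QPF.Fix.dest (F := TreeShape Dec) T).2

@[simp] theorem dec_node (c : Dec) (ts : Multiset (RTree Dec)) : (node c ts).dec = c := by
  exact congrArg Prod.fst (QPF.Fix.dest_mk (F := TreeShape Dec) (c, ts))

@[simp] theorem children_node (c : Dec) (ts : Multiset (RTree Dec)) :
    (node c ts).children = ts := by
  exact congrArg Prod.snd (QPF.Fix.dest_mk (F := TreeShape Dec) (c, ts))

@[simp] theorem node_dec_children (T : RTree Dec) : node T.dec T.children = T :=
  QPF.Fix.mk_dest (F := TreeShape Dec) T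

/-- Structural induction on trees. -/
theorem induction {p : RTree Dec → Prop}
    (h : ∀ c ts, (∀ t ∈ ts, p t) → p (node c ts)) (T : RTree Dec) : p T := by
  refine QPF.Fix.ind (F := TreeShape Dec) p (fun x hx => ?_) T
  obtain ⟨u, hu⟩ := hx
  refine h x.1 x.2 fun t ht => ?_
  have e : x.2 = Multiset.map Subtype.val u.2 := by rw [← hu]; rfl
  obtain ⟨s, -, hs⟩ := Multiset.mem_map.1 (e ▸ ht : t ∈ Multiset.map Subtype.val u.2)
  exact hs ▸ s.2

/-- `s` is a branch of `T` at the root. -/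
def IsChild (s T : RTree Dec) : Prop := s ∈ T.children

theorem isChild_wf : WellFounded (IsChild (Dec := Dec)) :=
  ⟨induction fun c ts ih => ⟨_, fun t ht => ih t (by simpa [IsChild] using ht)⟩⟩

/-- Recursion along proper subtrees. -/
instance : WellFoundedRelation (RTree Dec) :=
  ⟨Relation.TransGen IsChild, isChild_wf.transGen⟩

/-- The admissible cuts of a tree, the empty cut included and the full cut (which removes the
root) excluded, each one listed as the pair `(P^C(T), R^C(T))` of the pruned forest and the
remaining trunk.  For every branch `t` at the root, either the edge to `t` is cut, or it is kept
and `t` is subject to an admissible cut; the choices are independent of each other. -/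
def cuts (T : RTree Dec) : Multiset (Multiset (RTree Dec) × RTree Dec) :=
  (Multiset.Sections (T.children.attach.map fun t =>
    ((({t.1} : Multiset (RTree Dec)), (0 : Multiset (RTree Dec))) ::ₘ
      (cuts t.1).map fun C => (C.1, ({C.2} : Multiset (RTree Dec)))))).map
    fun s => ((s.map Prod.fst).sum, node T.dec (s.map Prod.snd).sum)
termination_by T
decreasing_by exact Relation.TransGen.single t.2

theorem cuts_node (c : Dec) (ts : Multiset (RTree Dec)) :
    cuts (node c ts) = (Multiset.Sections (ts.map fun t =>
      ((({t} : Multiset (RTree Dec)), (0 : Multiset (RTree Dec))) ::ₘ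
        (cuts t).map fun C => (C.1, ({C.2} : Multiset (RTree Dec)))))).map
      fun s => ((s.map Prod.fst).sum, node c (s.map Prod.snd).sum) := by
  rw [cuts, children_node, dec_node]
  congr 2
  exact Multiset.attach_map_val' ts (fun t =>
      ((({t} : Multiset (RTree Dec)), (0 : Multiset (RTree Dec))) ::ₘ
        (cuts t).map fun C => (C.1, ({C.2} : Multiset (RTree Dec)))))

/-- The trees that an admissible cut prunes are proper subtrees. -/
theorem transGen_of_mem_cuts (T : RTree Dec) :
    ∀ C ∈ cuts T, ∀ t ∈ C.1, Relation.TransGen IsChild t T := by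
  induction T using RTree.induction with
  | h c ts ih =>
    intro C hC t ht
    rw [cuts_node, Multiset.mem_map] at hC
    obtain ⟨s, hs, rfl⟩ := hC
    rw [Multiset.mem_sections, Multiset.rel_map_left] at hs
    obtain ⟨x, hx, htx⟩ : ∃ x ∈ s, t ∈ x.1 := by
      obtain ⟨a, ha, hta⟩ := Multiset.mem_join.1 (show t ∈ (s.map Prod.fst).join from ht)
      obtain ⟨x, hx, rfl⟩ := Multiset.mem_map.1 ha
      exact ⟨x, hx, hta⟩
    obtain ⟨b, hb, hbx⟩ := Multiset.exists_mem_of_rel_of_mem (Multiset.rel_flip.2 hs) hx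
    have hb' : IsChild b (node c ts) := by simpa [IsChild] using hb
    rcases Multiset.mem_cons.1 hbx with h | h
    · subst h
      rw [Multiset.mem_singleton] at htx
      subst htx
      exact .single hb'
    · obtain ⟨D, hD, rfl⟩ := Multiset.mem_map.1 h
      exact (ih b hb D hD t htx).tail hb'

end RTree

/-! ### The Hopf algebra of decorated rooted trees -/

/-- `H(Dec)`: the free commutative algebra on the trees; its monomials are the forests, the
product is disjoint union. -/
abbrev TreeAlg (Dec : Type u) : Type u := MvPolynomial (RTree Dec) ℂ

namespace TreeAlg

variable {Dec : Type u}

/-- A tree as an element of `H(Dec)`. -/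
abbrev ofTree (T : RTree Dec) : TreeAlg Dec := MvPolynomial.X T

/-- A forest as an element of `H(Dec)`. -/
def ofForest (F : Multiset (RTree Dec)) : TreeAlg Dec := (F.map ofTree).prod

/-- The coproduct: the algebra homomorphism with
`Δ(T) = T ⊗ e + ∑_C P^C(T) ⊗ R^C(T)`, where `C` runs through the admissible cuts of the tree `T`,
the empty cut, which contributes `e ⊗ T`, included. -/
def coproduct : TreeAlg Dec →ₐ[ℂ] TreeAlg Dec ⊗[ℂ] TreeAlg Dec :=
  MvPolynomial.aeval fun T =>
    ofTree T ⊗ₜ[ℂ] 1 + (T.cuts.map fun C => ofForest C.1 ⊗ₜ[ℂ] ofTree C.2).sum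

/-- The counit: `1` on the empty forest, `0` on all others. -/
def counit : TreeAlg Dec →ₐ[ℂ] ℂ := MvPolynomial.aeval fun _ => 0

/-- The projection `P = id - E ∘ ē` onto the augmentation ideal. -/
def augProj : TreeAlg Dec →ₗ[ℂ] TreeAlg Dec :=
  LinearMap.id - Algebra.linearMap ℂ (TreeAlg Dec) ∘ₗ counit.toLinearMap

variable {V : Type*} [CommRing V] [Algebra ℂ V]

/-- The convolution `φ * ψ = m_V ∘ (φ ⊗ ψ) ∘ Δ` of two characters of `H(Dec)`. -/
def convolution (φ ψ : TreeAlg Dec →ₐ[ℂ] V) : TreeAlg Dec →ₐ[ℂ] V :=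
  (Algebra.TensorProduct.lift φ ψ fun _ _ => Commute.all _ _).comp coproduct

/-- The counterterm of a tree: `S_R^φ(T) = -R[∑_C S_R^φ(P^C(T)) φ(R^C(T))]`, where `C` runs through
the admissible cuts of `T`, the empty cut included. -/
def countertermTree (R : V →ₗ[ℂ] V) (φ : TreeAlg Dec →ₐ[ℂ] V) (T : RTree Dec) : V :=
  -R (T.cuts.attach.map fun C =>
    (C.1.1.attach.map fun t => countertermTree R φ t.1).prod * φ (ofTree C.1.2)).sum
termination_by T
decreasing_by exact RTree.transGen_of_mem_cuts T C.1 C.2 t.1 t.2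

/-- The twisted antipode (counterterm) `S_R^φ`, as a character of `H(Dec)`. -/
def counterterm (R : V →ₗ[ℂ] V) (φ : TreeAlg Dec →ₐ[ℂ] V) : TreeAlg Dec →ₐ[ℂ] V :=
  MvPolynomial.aeval (countertermTree R φ)

/-- The Bogoliubov operation `φ̄_R = m_V ∘ (S_R^φ ⊗ φ) ∘ (id ⊗ P) ∘ Δ`. -/
def bogoliubov (R : V →ₗ[ℂ] V) (φ : TreeAlg Dec →ₐ[ℂ] V) : TreeAlg Dec →ₗ[ℂ] V :=
  (Algebra.TensorProduct.lift (counterterm R φ) φ fun _ _ => Commute.all _ _).toLinearMap ∘ₗ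
    LinearMap.lTensor (TreeAlg Dec) augProj ∘ₗ coproduct.toLinearMap

/-- The renormalized character `φ_R = S_R^φ * φ`. -/
def renormalized (R : V →ₗ[ℂ] V) (φ : TreeAlg Dec →ₐ[ℂ] V) : TreeAlg Dec →ₐ[ℂ] V :=
  convolution (counterterm R φ) φ

/-- The defining recursion of the counterterms: `S_R^φ(T) = -R[φ̄_R(T)]`. -/
theorem counterterm_ofTree (R : V →ₗ[ℂ] V) (φ : TreeAlg Dec →ₐ[ℂ] V) (T : RTree Dec) :
    counterterm R φ (ofTree T) = -R (bogoliubov R φ (ofTree T)) := by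
  have hF : ∀ F : Multiset (RTree Dec),
      counterterm R φ (ofForest F) = (F.map (countertermTree R φ)).prod := fun F => by
    rw [ofForest, map_multiset_prod, Multiset.map_map]
    congr 1
    exact Multiset.map_congr rfl fun t _ => MvPolynomial.aeval_X _ t
  have hP1 : augProj (1 : TreeAlg Dec) = 0 := by simp [augProj]
  have hPX : ∀ t : RTree Dec, augProj (ofTree t) = ofTree t := fun t => by
    simp [augProj, counit]
  have hbar : bogoliubov R φ (ofTree T) =
      (T.cuts.map fun C => (C.1.map (countertermTree R φ)).prod * φ (ofTree C.2)).sum := by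
    simp only [bogoliubov, coproduct, LinearMap.comp_apply, AlgHom.toLinearMap_apply,
      MvPolynomial.aeval_X, map_add, LinearMap.lTensor_tmul, hP1, TensorProduct.tmul_zero,
      map_multiset_sum, Multiset.map_map, Function.comp_def, hPX, zero_add,
      Algebra.TensorProduct.lift_tmul, hF]
  rw [hbar, counterterm, MvPolynomial.aeval_X, countertermTree]
  congr 3
  rw [← Multiset.attach_map_val' T.cuts
    fun C => (C.1.map (countertermTree R φ)).prod * φ (ofTree C.2)]
  refine Multiset.map_congr rfl fun C _ => ?_
  rw [Multiset.attach_map_val' C.1.1 (countertermTree R φ)]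

end TreeAlg

/-! ### Laurent series and momentum-dependent amplitudes -/

/-- `lim_{z → 0} a = l` for a Laurent series `a` in `z`: there is no polar part, and the constant
term is `l`. -/
def HasLimitAtZero (a : ℂ⸨X⸩) (l : ℂ) : Prop :=
  (∀ n : ℤ, n < 0 → a.coeff n = 0) ∧ a.coeff 0 = l

/-- The ring `V`: functions of the squared momentum `q² > 0` with values in the Laurent series
in `z` with poles of finite order. -/
def Amplitude : Type := Set.Ioi (0 : ℝ) → ℂ⸨X⸩

instance : CommRing Amplitude := inferInstanceAs (CommRing (Set.Ioi (0 : ℝ) → ℂ⸨X⸩))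

/-- Complex scalars act coefficientwise. -/
instance : Algebra ℂ Amplitude :=
  letI : Algebra ℂ ℂ⸨X⸩ := HahnSeries.instAlgebra
  inferInstanceAs (Algebra ℂ (Set.Ioi (0 : ℝ) → ℂ⸨X⸩))

/-- `a` is the Laurent expansion at `z = 0` of a function `g` that is given for small `z > 0`. -/
def HasLaurentExpansion (g : ℝ → ℂ) (a : ℂ⸨X⸩) : Prop :=
  ∀ᶠ z : ℝ in 𝓝[>] 0, HasSum (fun n : ℤ => a.coeff n * (z : ℂ) ^ n) (g z)

open Classical in
/-- The Laurent expansion at `z = 0` of a function `g` that is given for small `z > 0`. -/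
def laurentExpansion (g : ℝ → ℂ) : ℂ⸨X⸩ :=
  if h : ∃ a, HasLaurentExpansion g a then h.choose else 0

/-- `G = ∂F / ∂ log(q²/μ²)`, taken coefficientwise in `z`. -/
def HasLogDeriv (μ2 : Set.Ioi (0 : ℝ)) (F G : Amplitude) : Prop :=
  ∀ (q2 : Set.Ioi (0 : ℝ)) (n : ℤ),
    HasDerivAt (fun L : ℝ => (F ⟨μ2.1 * Real.exp L, mul_pos μ2.2 (Real.exp_pos L)⟩).coeff n)
      ((G q2).coeff n) (Real.log (q2.1 / μ2.1))

/-! ### The toy Feynman rules -/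

/-- The integral `∫ g(y²) d^D y` in dimension `D > 0`, in polar coordinates and with `r = y²` as
the variable of integration: `π^{D/2} / Γ(D/2) ∫_0^∞ g(r) r^{D/2 - 1} dr`. -/
def dimIntegral (D : ℝ) (g : ℝ → ℂ) : ℂ :=
  ((Real.pi ^ (D / 2) / Real.Gamma (D / 2) : ℝ) : ℂ) *
    ∫ r in Set.Ioi (0 : ℝ), g r * ((r ^ (D / 2 - 1) : ℝ) : ℂ)

variable {Dec : Type u}

/-- The toy Feynman rules on trees, as functions of `q²` and of the regulator `z = (2 - D)/2`, for
small `z > 0`, where all integrals converge: for `T = B_+^c(X)`,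
`φ(T) = [μ²]^{z|c|/2} ∫ f_c φ(X){y²} / (y² + q²) [y²]^{-z(|c|/2 - 1)} d^D y`, where `φ(X)` is the
product over the trees of the forest `X`. -/
def toyTree (deg : Dec → ℕ) (f : Dec → ℂ) (μ2 : ℝ) (T : RTree Dec) (q2 z : ℝ) : ℂ :=
  ((μ2 ^ (z * (deg T.dec / 2)) : ℝ) : ℂ) *
    dimIntegral (2 - 2 * z) fun r =>
      f T.dec * (T.children.attach.map fun t => toyTree deg f μ2 t.1 r z).prod /
        ((r + q2 : ℝ) : ℂ) * ((r ^ (-z * (deg T.dec / 2 - 1)) : ℝ) : ℂ)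
termination_by T
decreasing_by exact Relation.TransGen.single t.2

/-- The toy Feynman rules `φ : H(Dec) → V`: the character whose value at a tree is the Laurent
expansion at `z = 0` of its dimensionally regularized integral. -/
def toyFeynmanRules (deg : Dec → ℕ) (f : Dec → ℂ) (μ2 : Set.Ioi (0 : ℝ)) :
    TreeAlg Dec →ₐ[ℂ] Amplitude :=
  MvPolynomial.aeval fun T q2 => laurentExpansion fun z => toyTree deg f μ2.1 T q2.1 z

/-! ### Renormalization schemes -/

/-- The Rota–Baxter equation `R[ab] + R[a]R[b] = R[R[a]b] + R[aR[b]]`. -/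
def IsRotaBaxter {V : Type*} [CommRing V] [Algebra ℂ V] (R : V →ₗ[ℂ] V) : Prop :=
  ∀ a b : V, R (a * b) + R a * R b = R (R a * b) + R (a * R b)

/-- The scheme `R` does not introduce momentum dependence: a Laurent series that does not depend
on `q²` is mapped to another one, and an amplitude that has a limit as `z → 0` at every momentum is
mapped to a Laurent series that does not depend on `q²` and has a limit as `z → 0`. -/
def IsLocalScheme (R : Amplitude →ₗ[ℂ] Amplitude) : Prop :=
  (∀ a : ℂ⸨X⸩, ∃ b : ℂ⸨X⸩, R (fun _ => a) = fun _ => b) ∧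
    ∀ F : Amplitude, (∀ q2, ∃ l, HasLimitAtZero (F q2) l) →
      ∃ b : ℂ⸨X⸩, (∃ l, HasLimitAtZero b l) ∧ R F = fun _ => b

end

noncomputable section

universe u

/-! ### The Mellin integral of the propagator -/

/-! The Mellin integral of the propagator sends a power of the momentum to a power, so `φ(T)` is a
Laurent series in `z` times `x^n`, where `x = (q²/μ²)^(-z/2)` and `n` is the total degree of `T`.
Amplitudes thus become polynomials in `x` over Laurent series, and `B_+^c` becomes a linear operator
`graft` that shifts exponents by `d = |c|` and multiplies `x^j` by a regular factor over `(j+d)z/2`.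

To a power series `h` belongs the functional `x^j ↦ h(jz)` (`pairing`). The moments are the pairings
with `X^k`; the zeroth is the value at `q² = μ²`, and pairing with `exp(-Lz/2)` evaluates at
`log(q²/μ²) = L`. Call a polynomial finite if no moment has a pole. Finite polynomials form a ring,
by the Leibniz rule for the Euler operator (`IsFinite.mul`), and all their pairings are regular
(`IsFinite.pairing_mem`). In a moment of positive order the factor `(j+d)z` cancels the pole of
grafting (`pairing_X_mul_graft`), so grafting a finite polynomial can only spoil the zeroth moment.

If counterterms do not depend on the momentum, the Bogoliubov operation on `B_+^c(∏ t)` is the graft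
of the product of the renormalized branches (`bogoliubovPoly_node`). By induction the branches are
finite, so the positive moments are regular. They govern the logarithmic derivative, which gives
(ii), and they make the polar part a constant in `q²`, so that the counterterm is again constant. It
remains to see that `R` removes this pole. Condition (a) on a one-vertex tree says so for one series
with a simple pole, and the Rota–Baxter identity extends it to all poles by induction on their order
(`sub_constScheme_mem`). -/

theorem image_mul_div_one_sub {q : ℝ} (hq : 0 < q) :
    (fun u : ℝ => q * u / (1 - u)) '' Set.Ioo 0 1 = Set.Ioi 0 := by
  ext r
  simp only [Set.mem_image, Set.mem_Ioo, Set.mem_Ioi]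
  constructor
  · rintro ⟨u, ⟨h0, h1⟩, rfl⟩
    exact div_pos (mul_pos hq h0) (by linarith)
  · intro hr
    refine ⟨r / (r + q), ⟨by positivity, (div_lt_one (by positivity)).2 (by linarith)⟩, ?_⟩
    rw [one_sub_div (by positivity), add_sub_cancel_left, mul_div_assoc', div_div_div_cancel_right₀
      (by positivity), mul_div_cancel_left₀ _ hq.ne']

/-- The substitution `r = qu/(1-u)` turns the integral into `q^(-s)` times the Beta integral `B(1-s,
s)`. -/
theorem integral_rpow_div_add {q s : ℝ} (hq : 0 < q) (h0 : 0 < s) (h1 : s < 1) :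
    ∫ r in Set.Ioi (0 : ℝ), (((r ^ (-s) / (r + q) : ℝ)) : ℂ) =
      ((q ^ (-s) * (Real.Gamma s * Real.Gamma (1 - s)) : ℝ) : ℂ) := by
  have hder : ∀ u ∈ Set.Ioo (0 : ℝ) 1, HasDerivWithinAt (fun u : ℝ => q * u / (1 - u))
      (q / (1 - u) ^ 2) (Set.Ioo 0 1) u := fun u hu => by
    have h : (1 - u) ≠ 0 := by linarith [hu.2]
    have := (((hasDerivAt_id u).const_mul q).div ((hasDerivAt_id u).const_sub 1) h)
    refine (this.congr_deriv ?_).hasDerivWithinAt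
    simp only [id]
    ring
  have hinj : Set.InjOn (fun u : ℝ => q * u / (1 - u)) (Set.Ioo 0 1) := by
    intro u hu v hv h
    have hu' : (1 - u) ≠ 0 := by linarith [hu.2]
    have hv' : (1 - v) ≠ 0 := by linarith [hv.2]
    simp only at h
    rw [div_eq_div_iff hu' hv'] at h
    have : q * (u - v) = 0 := by linarith
    rcases mul_eq_zero.1 this with h | h
    · exact absurd h hq.ne'
    · linarith
  rw [← image_mul_div_one_sub hq,
    integral_image_eq_integral_abs_deriv_smul measurableSet_Ioo hder hinj]
  have hB : Complex.betaIntegral ((1 - s : ℝ) : ℂ) (s : ℂ) =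
      ((Real.Gamma s * Real.Gamma (1 - s) : ℝ) : ℂ) := by
    have := Complex.Gamma_mul_Gamma_eq_betaIntegral (s := ((1 - s : ℝ) : ℂ)) (t := (s : ℂ))
      (by simpa using h1) (by simpa using h0)
    rw [← Complex.ofReal_add, sub_add_cancel, Complex.ofReal_one, Complex.Gamma_one, one_mul] at this
    rw [← this, Complex.Gamma_ofReal, Complex.Gamma_ofReal]
    push_cast
    ring
  rw [Complex.ofReal_mul, ← hB, Complex.betaIntegral, intervalIntegral.integral_of_le zero_le_one,
    integral_Ioc_eq_integral_Ioo, ← integral_const_mul]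
  refine setIntegral_congr_fun measurableSet_Ioo fun u hu => ?_
  have hu0 := hu.1
  have hu1 : 0 < 1 - u := by linarith [hu.2]
  have e1 : ((u : ℂ) ^ (((1 - s : ℝ) : ℂ) - 1)) = ((u ^ (-s) : ℝ) : ℂ) := by
    rw [Complex.ofReal_cpow hu0.le]; congr 1; push_cast; ring
  have e2 : ((1 - u : ℂ) ^ ((s : ℂ) - 1)) = (((1 - u) ^ (s - 1) : ℝ) : ℂ) := by
    rw [Complex.ofReal_cpow hu1.le]; push_cast; rfl
  simp only [e1, e2, Complex.real_smul]
  rw [← Complex.ofReal_mul, ← Complex.ofReal_mul, ← Complex.ofReal_mul, Complex.ofReal_inj,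
    abs_of_pos (by positivity), Real.div_rpow (by positivity) hu1.le, Real.mul_rpow hq.le hu0.le,
    Real.rpow_sub_one hu1.ne', Real.rpow_neg hu1.le]
  have e3 : q * u / (1 - u) + q = q / (1 - u) := by field_simp; ring
  have := (Real.rpow_pos_of_pos hu1 s).ne'
  rw [e3]
  field_simp

/-! ### Laurent expansions -/

/-- A function of a small positive real number is the sum of a power series. -/
def HasPowerSeriesSum (g : ℝ → ℂ) (p : PowerSeries ℂ) : Prop :=
  ∀ᶠ z : ℝ in 𝓝[>] 0, HasSum (fun n : ℕ => PowerSeries.coeff n p * (z : ℂ) ^ n) (g z)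

theorem HasPowerSeriesSum.mul {g h : ℝ → ℂ} {p q : PowerSeries ℂ} (hg : HasPowerSeriesSum g p)
    (hh : HasPowerSeriesSum h q) : HasPowerSeriesSum (fun z => g z * h z) (p * q) := by
  filter_upwards [hg, hh] with z hp hq
  have e : (fun n : ℕ => PowerSeries.coeff n (p * q) * (z : ℂ) ^ n) = fun n : ℕ =>
      ∑ kl ∈ Finset.HasAntidiagonal.antidiagonal n, (PowerSeries.coeff kl.1 p * (z : ℂ) ^ kl.1) *
        (PowerSeries.coeff kl.2 q * (z : ℂ) ^ kl.2) := by
    funext n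
    rw [PowerSeries.coeff_mul, Finset.sum_mul]
    refine Finset.sum_congr rfl fun kl hkl => ?_
    rw [← Finset.HasAntidiagonal.mem_antidiagonal.1 hkl, pow_add]
    ring
  rw [e]
  have hp' := hp.summable.norm
  have hq' := hq.summable.norm
  rw [← hp.tsum_eq, ← hq.tsum_eq,
    tsum_mul_tsum_eq_tsum_sum_antidiagonal_of_summable_norm hp' hq']
  exact (summable_norm_sum_mul_antidiagonal_of_summable_norm hp' hq').of_norm.hasSum

/-- Absolute convergence at a single `z₀ > 0` dominates the series for all smaller `z`. -/
theorem HasPowerSeriesSum.tendsto {g : ℝ → ℂ} {p : PowerSeries ℂ} (h : HasPowerSeriesSum g p) :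
    Tendsto g (𝓝[>] 0) (𝓝 (PowerSeries.constantCoeff p)) := by
  obtain ⟨z₀, hs, hz₀⟩ := (Filter.Eventually.and h self_mem_nhdsWithin).exists
  have hz₀' : 0 < z₀ := hz₀
  have key := tendsto_tsum_of_dominated_convergence (𝓕 := 𝓝[>] (0 : ℝ))
    (f := fun z n => PowerSeries.coeff n p * (z : ℂ) ^ n)
    (g := fun n => PowerSeries.coeff n p * (0 : ℂ) ^ n) hs.summable.norm (fun n => ?_) ?_
  · have e : ∑' n, PowerSeries.coeff n p * (0 : ℂ) ^ n = PowerSeries.constantCoeff p := by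
      rw [tsum_eq_single 0 fun n hn => by simp [hn]]
      simp
    rw [e] at key
    refine key.congr' ?_
    filter_upwards [h] with z hz using hz.tsum_eq
  · refine Tendsto.const_mul _ (Tendsto.pow ?_ n)
    exact (Complex.continuous_ofReal.tendsto' 0 0 (by simp)).mono_left nhdsWithin_le_nhds
  · filter_upwards [Ioo_mem_nhdsGT hz₀'] with z hz n
    rw [norm_mul, norm_mul, norm_pow, norm_pow, Complex.norm_real, Complex.norm_real,
      Real.norm_of_nonneg hz.1.le, Real.norm_of_nonneg hz₀'.le]
    gcongr
    · exact hz.1.le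
    · exact hz.2.le

/-- One series serves every scale `c`; grafting needs the same Gamma factor at the scales `(j+d)/2`.
-/
theorem AnalyticAt.exists_powerSeries {F : ℂ → ℂ} (hF : AnalyticAt ℂ F 0) :
    ∃ p : PowerSeries ℂ, PowerSeries.constantCoeff p = F 0 ∧
      ∀ c : ℝ, HasPowerSeriesSum (fun z => F ((c * z : ℝ))) (PowerSeries.rescale (c : ℂ) p) := by
  obtain ⟨q, hq⟩ := hF
  have hsum := hq.eventually_hasSum
  refine ⟨PowerSeries.mk q.coeff, ?_, fun c => ?_⟩
  · rw [← PowerSeries.coeff_zero_eq_constantCoeff_apply, PowerSeries.coeff_mk]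
    exact hq.coeff_zero 1
  · have ht : Tendsto (fun z : ℝ => ((c * z : ℝ) : ℂ)) (𝓝[>] 0) (𝓝 0) :=
      ((by fun_prop : Continuous fun z : ℝ => ((c * z : ℝ) : ℂ)).tendsto' 0 0
        (by simp)).mono_left nhdsWithin_le_nhds
    filter_upwards [ht.eventually hsum] with z hz
    rw [zero_add] at hz
    refine hz.congr_fun fun n => ?_
    rw [PowerSeries.coeff_rescale, PowerSeries.coeff_mk,
      FormalMultilinearSeries.apply_eq_pow_smul_coeff, smul_eq_mul]
    push_cast
    ring

theorem LaurentSeries.exists_eq_single_mul (a : ℂ⸨X⸩) : ∃ (m : ℤ) (p : PowerSeries ℂ),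
    a = HahnSeries.single m 1 * HahnSeries.ofPowerSeries ℤ ℂ p :=
  ⟨_, _, (LaurentSeries.single_order_mul_powerSeriesPart a).symm⟩

theorem hasSum_single_mul_ofPowerSeries {m : ℤ} {p : PowerSeries ℂ} {w s : ℂ} (hw : w ≠ 0) :
    HasSum (fun n : ℤ => (HahnSeries.single m (1 : ℂ) *
      HahnSeries.ofPowerSeries ℤ ℂ p).coeff n * w ^ n) s ↔
    HasSum (fun n : ℕ => PowerSeries.coeff n p * w ^ n) (w ^ (-m) * s) := by
  have hinj : Function.Injective fun n : ℕ => (n : ℤ) + m := fun i j h => by simpa using h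
  rw [← hinj.hasSum_iff, ← hasSum_mul_left_iff (zpow_ne_zero (-m) hw)]
  · refine iff_of_eq (congrArg (HasSum · _) (funext fun n => ?_))
    simp only [Function.comp, HahnSeries.coeff_single_mul, add_sub_cancel_right, one_mul,
      HahnSeries.ofPowerSeries_apply_coeff]
    rw [zpow_add₀ hw, zpow_neg, zpow_natCast]
    field_simp
  · intro k hk
    rw [HahnSeries.coeff_single_mul, one_mul, PowerSeries.coeff_coe, if_pos, zero_mul]
    by_contra hneg
    exact hk ⟨(k - m).toNat, by simp only; omega⟩

theorem hasLaurentExpansion_single_mul {g : ℝ → ℂ} {m : ℤ} {p : PowerSeries ℂ} :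
    HasLaurentExpansion g (HahnSeries.single m 1 * HahnSeries.ofPowerSeries ℤ ℂ p) ↔
      HasPowerSeriesSum (fun z => (z : ℂ) ^ (-m) * g z) p :=
  eventually_congr <| eventually_mem_nhdsWithin.mono fun _ hz =>
    hasSum_single_mul_ofPowerSeries (Complex.ofReal_ne_zero.2 (ne_of_gt hz))

namespace HasLaurentExpansion

theorem of_powerSeries {g : ℝ → ℂ} {p : PowerSeries ℂ} (h : HasPowerSeriesSum g p) :
    HasLaurentExpansion g (HahnSeries.ofPowerSeries ℤ ℂ p) := by
  have := hasLaurentExpansion_single_mul (g := g) (m := 0) (p := p)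
  rw [show HahnSeries.single (0 : ℤ) (1 : ℂ) = 1 from rfl, one_mul] at this
  exact this.2 (by simpa using h)

theorem mul {g h : ℝ → ℂ} {a b : ℂ⸨X⸩} (hg : HasLaurentExpansion g a)
    (hh : HasLaurentExpansion h b) : HasLaurentExpansion (fun z => g z * h z) (a * b) := by
  obtain ⟨m, p, rfl⟩ := LaurentSeries.exists_eq_single_mul a
  obtain ⟨n, q, rfl⟩ := LaurentSeries.exists_eq_single_mul b
  rw [mul_mul_mul_comm, HahnSeries.single_mul_single, one_mul, ← map_mul]
  rw [hasLaurentExpansion_single_mul] at *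
  filter_upwards [hg.mul hh, self_mem_nhdsWithin] with z hz hz0
  convert hz using 1
  rw [neg_add, zpow_add₀ (Complex.ofReal_ne_zero.2 (ne_of_gt hz0))]
  ring

theorem congr {g h : ℝ → ℂ} {a : ℂ⸨X⸩} (hg : HasLaurentExpansion g a)
    (e : ∀ᶠ z in 𝓝[>] 0, g z = h z) : HasLaurentExpansion h a := by
  filter_upwards [hg, e] with z hz hze
  rwa [← hze]

/-- The difference of two expansions expands the zero function. Divided by its leading power of `z`,
it tends to its leading coefficient, which must therefore vanish. -/
theorem unique {g : ℝ → ℂ} {a b : ℂ⸨X⸩} (ha : HasLaurentExpansion g a)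
    (hb : HasLaurentExpansion g b) : a = b := by
  by_contra hab
  have hc : HasLaurentExpansion (fun _ => 0) (a - b) := by
    filter_upwards [ha, hb] with z h1 h2
    simpa [sub_mul] using h1.sub h2
  have hne : a - b ≠ 0 := sub_ne_zero.2 hab
  rw [← LaurentSeries.single_order_mul_powerSeriesPart (a - b),
    hasLaurentExpansion_single_mul] at hc
  have h0 := tendsto_nhds_unique hc.tendsto 
    (tendsto_const_nhds.congr fun _ => (mul_zero _).symm)
  rw [← PowerSeries.coeff_zero_eq_constantCoeff_apply, LaurentSeries.powerSeriesPart_coeff] at h0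
  simp only [Nat.cast_zero, add_zero] at h0
  exact hne (HahnSeries.coeff_order_eq_zero.1 h0)

theorem laurentExpansion_eq {g : ℝ → ℂ} {a : ℂ⸨X⸩} (h : HasLaurentExpansion g a) :
    laurentExpansion g = a := by
  have hex : ∃ a, HasLaurentExpansion g a := ⟨a, h⟩
  rw [laurentExpansion, dif_pos hex]
  exact hex.choose_spec.unique h

end HasLaurentExpansion

/-! ### Laurent series without polar part -/

/-- The Laurent series without polar part. -/
def regularSeries : Subring ℂ⸨X⸩ := (HahnSeries.ofPowerSeries ℤ ℂ).range

theorem ofPowerSeries_mem_regularSeries (p : PowerSeries ℂ) :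
    HahnSeries.ofPowerSeries ℤ ℂ p ∈ regularSeries := ⟨p, rfl⟩

theorem mem_regularSeries_iff {a : ℂ⸨X⸩} : a ∈ regularSeries ↔ ∀ n : ℤ, n < 0 → a.coeff n = 0 := by
  constructor
  · rintro ⟨p, rfl⟩ n hn
    rw [PowerSeries.coeff_coe, if_pos hn]
  · intro h
    refine ⟨PowerSeries.mk fun n => a.coeff n, ?_⟩
    ext n
    rw [PowerSeries.coeff_coe]
    split_ifs with hn
    · exact (h n hn).symm
    · rw [PowerSeries.coeff_mk, Int.natAbs_of_nonneg (not_lt.1 hn)]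

theorem exists_hasLimitAtZero_iff {a : ℂ⸨X⸩} : (∃ l, HasLimitAtZero a l) ↔ a ∈ regularSeries := by
  simp [HasLimitAtZero, mem_regularSeries_iff]

theorem exists_ofPowerSeries_X_pow_mul_mem (a : ℂ⸨X⸩) :
    ∃ N : ℕ, ∀ n ≥ N, HahnSeries.ofPowerSeries ℤ ℂ (PowerSeries.X ^ n) * a ∈ regularSeries := by
  refine ⟨(-a.order).toNat, fun n hn => mem_regularSeries_iff.2 fun k hk => ?_⟩
  rw [HahnSeries.ofPowerSeries_X_pow, HahnSeries.coeff_single_mul, one_mul]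
  exact HahnSeries.coeff_eq_zero_of_lt_order (by omega)

/-! ### Exponential polynomials -/

namespace ExpPoly

open PowerSeries in
/-- The functional `∑ s_j x^j ↦ ∑ s_j h(j z)`. -/
def pairing (h : PowerSeries ℂ) : Polynomial ℂ⸨X⸩ →ₗ[ℂ⸨X⸩] ℂ⸨X⸩ :=
  Polynomial.lsum fun j =>
    LinearMap.mulLeft ℂ⸨X⸩ (HahnSeries.ofPowerSeries ℤ ℂ (rescale (j : ℂ) h))

theorem pairing_monomial (h : PowerSeries ℂ) (j : ℕ) (s : ℂ⸨X⸩) :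
    pairing h (Polynomial.monomial j s) =
      HahnSeries.ofPowerSeries ℤ ℂ (PowerSeries.rescale (j : ℂ) h) * s := by
  rw [pairing, Polynomial.lsum_apply, Polynomial.sum_monomial_index _ _ (by simp)]
  rfl

theorem pairing_add (h h' : PowerSeries ℂ) (p : Polynomial ℂ⸨X⸩) :
    pairing (h + h') p = pairing h p + pairing h' p := by
  induction p using Polynomial.induction_on' with
  | add p q hp hq => rw [map_add, hp, hq, map_add, map_add]; ring
  | monomial j s => simp only [pairing_monomial, map_add, add_mul]

theorem rescale_C (a b : ℂ) : PowerSeries.rescale a (PowerSeries.C b) = PowerSeries.C b := by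
  ext n
  rw [PowerSeries.coeff_rescale, PowerSeries.coeff_C]
  split_ifs with h <;> simp [h]

theorem pairing_C_mul (a : ℂ) (h : PowerSeries ℂ) (p : Polynomial ℂ⸨X⸩) :
    pairing (PowerSeries.C a * h) p =
      HahnSeries.ofPowerSeries ℤ ℂ (PowerSeries.C a) * pairing h p := by
  induction p using Polynomial.induction_on' with
  | add p q hp hq => rw [map_add, hp, hq, map_add, mul_add]
  | monomial j s => simp only [pairing_monomial, map_mul, rescale_C, mul_assoc]

theorem pairing_one (p : Polynomial ℂ⸨X⸩) : pairing 1 p = p.eval 1 := by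
  induction p using Polynomial.induction_on' with
  | add p q hp hq => rw [map_add, hp, hq, Polynomial.eval_add]
  | monomial j s => simp [pairing_monomial]

/-- The Euler operator `x^j ↦ (j z) x^j`. -/
def euler (p : Polynomial ℂ⸨X⸩) : Polynomial ℂ⸨X⸩ :=
  Polynomial.C (HahnSeries.ofPowerSeries ℤ ℂ PowerSeries.X) *
    (Polynomial.X * Polynomial.derivative p)

theorem euler_mul (p q : Polynomial ℂ⸨X⸩) : euler (p * q) = euler p * q + p * euler q := by
  simp only [euler, Polynomial.derivative_mul]
  ring

/-- The Euler operator is the transpose of multiplication by `X`, so a moment of order `k + 1` is a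
moment of order `k` after a derivation. -/
theorem pairing_X_mul (h : PowerSeries ℂ) (p : Polynomial ℂ⸨X⸩) :
    pairing (PowerSeries.X * h) p = pairing h (euler p) := by
  induction p using Polynomial.induction_on' with
  | add p q hp hq =>
    rw [map_add, hp, hq, ← map_add]
    simp only [euler, Polynomial.derivative_add, mul_add]
  | monomial j s =>
    have : euler (Polynomial.monomial j s) = Polynomial.monomial j
        (HahnSeries.ofPowerSeries ℤ ℂ PowerSeries.X * (s * j)) := by
      rw [euler, Polynomial.derivative_monomial, Polynomial.X_mul_monomial,
        Polynomial.C_mul_monomial]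
      rcases j with _ | j
      · simp
      · simp
    rw [this, pairing_monomial, pairing_monomial, map_mul, map_mul, PowerSeries.rescale_X, map_mul,
      map_natCast, map_natCast]
    ring

/-- An exponential polynomial all of whose moments are free of poles. -/
def IsFinite (p : Polynomial ℂ⸨X⸩) : Prop :=
  ∀ k : ℕ, pairing (PowerSeries.X ^ k) p ∈ regularSeries

theorem IsFinite.euler {p : Polynomial ℂ⸨X⸩} (hp : IsFinite p) : IsFinite (euler p) := fun k => by
  rw [← pairing_X_mul, ← pow_succ']
  exact hp _

/-- The zeroth moment is evaluation at `x = 1`, hence multiplicative; higher moments reduce to lower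
ones of `euler p * q` and `p * euler q`, which is why the induction varies both factors. -/
theorem IsFinite.mul {p q : Polynomial ℂ⸨X⸩} (hp : IsFinite p) (hq : IsFinite q) :
    IsFinite (p * q) := by
  intro k
  induction k generalizing p q with
  | zero =>
    rw [pow_zero, pairing_one, Polynomial.eval_mul, ← pairing_one, ← pairing_one]
    simpa using mul_mem (hp 0) (hq 0)
  | succ k ih =>
    rw [pow_succ', pairing_X_mul, euler_mul, map_add]
    exact add_mem (ih hp.euler hq) (ih hp hq.euler)

theorem isFinite_monomial_one (n : ℕ) : IsFinite (Polynomial.monomial n 1) := fun k => by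
  rw [pairing_monomial, mul_one]
  exact ofPowerSeries_mem_regularSeries _

theorem isFinite_multiset_prod (s : Multiset (Polynomial ℂ⸨X⸩)) (h : ∀ p ∈ s, IsFinite p) :
    IsFinite s.prod := by
  refine Multiset.prod_induction IsFinite s (fun _ _ => IsFinite.mul) ?_ h
  exact isFinite_monomial_one 0

/-- `X^n` contributes `(jz)^n`, and the finitely many coefficients have poles of bounded order; the
bound does not involve `h`. -/
theorem exists_pairing_X_pow_mul_mem (p : Polynomial ℂ⸨X⸩) :
    ∃ N : ℕ, ∀ n ≥ N, ∀ h, pairing (PowerSeries.X ^ n * h) p ∈ regularSeries := by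
  induction p using Polynomial.induction_on' with
  | add p q hp hq =>
    obtain ⟨M, hM⟩ := hp
    obtain ⟨N, hN⟩ := hq
    refine ⟨max M N, fun n hn h => ?_⟩
    rw [map_add]
    exact add_mem (hM n (le_of_max_le_left hn) h) (hN n (le_of_max_le_right hn) h)
  | monomial j s =>
    obtain ⟨N, hN⟩ := exists_ofPowerSeries_X_pow_mul_mem s
    refine ⟨N, fun n hn h => ?_⟩
    have : HahnSeries.ofPowerSeries ℤ ℂ (PowerSeries.rescale (j : ℂ) (PowerSeries.X ^ n * h)) * s =
        HahnSeries.ofPowerSeries ℤ ℂ (PowerSeries.C ((j : ℂ) ^ n) * PowerSeries.rescale (j : ℂ) h) *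
          (HahnSeries.ofPowerSeries ℤ ℂ (PowerSeries.X ^ n) * s) := by
      rw [map_mul, map_pow, PowerSeries.rescale_X, mul_pow, ← map_pow, ← mul_assoc, ← map_mul]
      congr 2
      ring
    rw [pairing_monomial, this]
    exact mul_mem (ofPowerSeries_mem_regularSeries _) (hN n hn)

theorem pairing_mem_of_moments {p : Polynomial ℂ⸨X⸩} {k₀ : ℕ}
    (hp : ∀ k ≥ k₀, pairing (PowerSeries.X ^ k) p ∈ regularSeries) (h : PowerSeries ℂ) :
    pairing (PowerSeries.X ^ k₀ * h) p ∈ regularSeries := by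
  obtain ⟨N, hN⟩ := exists_pairing_X_pow_mul_mem p
  -- From the exponent `N` on regularity is automatic. Descending from there, each step splits off
  -- one constant coefficient of the test series, so only finitely many moments are used.
  have key : ∀ m n : ℕ, k₀ ≤ n → n + m ≥ N →
      ∀ h, pairing (PowerSeries.X ^ n * h) p ∈ regularSeries := by
    intro m
    induction m with
    | zero => exact fun n _ hn h => hN n hn h
    | succ m ih =>
      intro n h0 hn h
      have e : PowerSeries.X ^ n * h = PowerSeries.X ^ (n + 1) *
          (PowerSeries.mk fun p => PowerSeries.coeff (p + 1) h) +
            PowerSeries.C (PowerSeries.constantCoeff h) * PowerSeries.X ^ n := by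
        conv_lhs => rw [PowerSeries.eq_X_mul_shift_add_const h]
        ring
      rw [e, pairing_add, pairing_C_mul]
      exact add_mem (ih (n + 1) (by omega) (by omega) _)
        (mul_mem (ofPowerSeries_mem_regularSeries _) (hp n h0))
  exact key N k₀ le_rfl (by omega) h

theorem IsFinite.pairing_mem {p : Polynomial ℂ⸨X⸩} (hp : IsFinite p) (h : PowerSeries ℂ) :
    pairing h p ∈ regularSeries := by
  simpa using pairing_mem_of_moments (k₀ := 0) (fun k _ => hp k) h

/-! ### Grafting -/

/-- The operator `x^j ↦ k · g((j + d) z / 2) / ((j + d) z / 2) · x^(j + d)`. -/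
def graft (k g : PowerSeries ℂ) (d : ℕ) : Polynomial ℂ⸨X⸩ →ₗ[ℂ⸨X⸩] Polynomial ℂ⸨X⸩ :=
  Polynomial.lsum fun j => Polynomial.monomial (j + d) ∘ₗ LinearMap.mulLeft ℂ⸨X⸩
    (HahnSeries.single (-1) (2 / ((j + d : ℕ) : ℂ)) * HahnSeries.ofPowerSeries ℤ ℂ
      (k * PowerSeries.rescale (((j + d : ℕ) : ℂ) / 2) g))

theorem graft_monomial (k g : PowerSeries ℂ) (d j : ℕ) (s : ℂ⸨X⸩) :
    graft k g d (Polynomial.monomial j s) = Polynomial.monomial (j + d)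
      (HahnSeries.single (-1) (2 / ((j + d : ℕ) : ℂ)) * HahnSeries.ofPowerSeries ℤ ℂ
        (k * PowerSeries.rescale (((j + d : ℕ) : ℂ) / 2) g) * s) := by
  rw [graft, Polynomial.lsum_apply, Polynomial.sum_monomial_index _ _ (by simp)]
  rfl

theorem graft_zero (g : PowerSeries ℂ) (d : ℕ) (p : Polynomial ℂ⸨X⸩) : graft 0 g d p = 0 := by
  induction p using Polynomial.induction_on' with
  | add p q hp hq => rw [map_add, hp, hq, add_zero]
  | monomial j s => simp [graft_monomial]

/-- On `x^(j+d)` the series `X` takes the value `(j+d)z`, which cancels the factor `2/((j+d)z)` of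
grafting. The assumption `1 ≤ d` keeps `j + d` from vanishing. -/
theorem pairing_X_mul_graft (k g : PowerSeries ℂ) {d : ℕ} (hd : 1 ≤ d) (h : PowerSeries ℂ)
    (p : Polynomial ℂ⸨X⸩) : pairing (PowerSeries.X * h) (graft k g d p) =
      HahnSeries.ofPowerSeries ℤ ℂ (PowerSeries.C 2 * k) *
        pairing (PowerSeries.rescale (1 / 2) g * h) (Polynomial.monomial d 1 * p) := by
  induction p using Polynomial.induction_on' with
  | add p q hp hq => rw [map_add, map_add, hp, hq, mul_add, map_add, mul_add]
  | monomial j s =>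
    have hv : ((j + d : ℕ) : ℂ) ≠ 0 := Nat.cast_ne_zero.2 (by omega)
    have e : HahnSeries.single (-1 : ℤ) (2 / ((j + d : ℕ) : ℂ)) * HahnSeries.ofPowerSeries ℤ ℂ
        (PowerSeries.C ((j + d : ℕ) : ℂ) * PowerSeries.X) =
          HahnSeries.ofPowerSeries ℤ ℂ (PowerSeries.C 2) := by
      rw [map_mul, HahnSeries.ofPowerSeries_X, HahnSeries.ofPowerSeries_C,
        HahnSeries.ofPowerSeries_C, HahnSeries.C_apply, HahnSeries.C_apply,
        HahnSeries.single_mul_single, HahnSeries.single_mul_single]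
      congr 1
      field_simp
    -- The Gamma factor `g((j+d)z/2)` is the test series `g(X/2)` taken at the exponent `j + d`, and
    -- can thus be absorbed into the pairing.
    have e2 : PowerSeries.rescale (((j + d : ℕ) : ℂ) / 2) g =
        PowerSeries.rescale ((j + d : ℕ) : ℂ) (PowerSeries.rescale (1 / 2) g) := by
      rw [PowerSeries.rescale_rescale]
      congr 2
      ring
    rw [graft_monomial, Polynomial.monomial_mul_monomial, one_mul, pairing_monomial, add_comm d j,
      pairing_monomial, map_mul, PowerSeries.rescale_X, e2]
    simp only [map_mul] at e ⊢
    rw [← e]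
    ring

theorem pairing_X_mul_graft_mem (k g : PowerSeries ℂ) {d : ℕ} (hd : 1 ≤ d)
    {p : Polynomial ℂ⸨X⸩} (hp : IsFinite p) (h : PowerSeries ℂ) :
    pairing (PowerSeries.X * h) (graft k g d p) ∈ regularSeries := by
  rw [pairing_X_mul_graft k g hd]
  exact mul_mem (ofPowerSeries_mem_regularSeries _)
    (((isFinite_monomial_one d).mul hp).pairing_mem _)

/-! ### Evaluation -/

/-- The power series `exp (-L z / 2)`. -/
def expSeries (L : ℝ) : PowerSeries ℂ := PowerSeries.rescale (-L / 2 : ℂ) (PowerSeries.exp ℂ)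

theorem coeff_expSeries (L : ℝ) (n : ℕ) :
    PowerSeries.coeff n (expSeries L) = (-1 / 2) ^ n * (1 / n.factorial : ℂ) * (L : ℂ) ^ n := by
  rw [expSeries, PowerSeries.coeff_rescale, PowerSeries.coeff_exp]
  simp only [one_div, map_inv₀, map_natCast]
  rw [show (-L / 2 : ℂ) = (-1 / 2) * L by ring, mul_pow]
  ring

/-- Evaluation at `x = exp (-L z / 2)`. -/
def evalLog (L : ℝ) : Polynomial ℂ⸨X⸩ →+* ℂ⸨X⸩ :=
  Polynomial.evalRingHom (HahnSeries.ofPowerSeries ℤ ℂ (expSeries L))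

theorem evalLog_monomial (L : ℝ) (j : ℕ) (s : ℂ⸨X⸩) : evalLog L (Polynomial.monomial j s) =
    HahnSeries.ofPowerSeries ℤ ℂ (PowerSeries.rescale (j : ℂ) (expSeries L)) * s := by
  rw [evalLog, Polynomial.coe_evalRingHom, Polynomial.eval_monomial, ← map_pow, expSeries,
    ← map_pow, PowerSeries.exp_pow_eq_rescale_exp, PowerSeries.rescale_rescale,
    PowerSeries.rescale_rescale, mul_comm s]
  simp only [mul_comm]

theorem evalLog_eq_pairing (L : ℝ) (p : Polynomial ℂ⸨X⸩) :
    evalLog L p = pairing (expSeries L) p := by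
  induction p using Polynomial.induction_on' with
  | add p q hp hq => rw [map_add, hp, hq, map_add]
  | monomial j s => rw [evalLog_monomial, pairing_monomial]

/-- The finite combination is the same for all `q`; a dependence of `q` on `L` can thus be
differentiated term by term. -/
theorem coeff_ofPowerSeries_mul {s : ℂ⸨X⸩} (n : ℤ) : ∃ (N : ℕ) (c : ℕ → ℂ),
    ∀ q : PowerSeries ℂ, (HahnSeries.ofPowerSeries ℤ ℂ q * s).coeff n =
      ∑ i ∈ Finset.range N, c i * PowerSeries.coeff i q := by
  obtain ⟨m, r, rfl⟩ := LaurentSeries.exists_eq_single_mul s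
  by_cases h : n - m < 0
  · refine ⟨0, 0, fun q => ?_⟩
    rw [mul_left_comm, HahnSeries.coeff_single_mul, ← map_mul, PowerSeries.coeff_coe, if_pos h]
    simp
  · refine ⟨(n - m).natAbs + 1, fun i => PowerSeries.coeff ((n - m).natAbs - i) r, fun q => ?_⟩
    rw [mul_left_comm, HahnSeries.coeff_single_mul, ← map_mul, PowerSeries.coeff_coe, if_neg h,
      one_mul, PowerSeries.coeff_mul, Finset.Nat.sum_antidiagonal_eq_sum_range_succ_mk]
    exact Finset.sum_congr rfl fun i _ => mul_comm _ _

/-- The coefficient of `z^i` in `exp(-jLz/2)` is a multiple of `L^i`, and only finitely many `i`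
contribute. -/
theorem exists_polynomial_coeff_evalLog (p : Polynomial ℂ⸨X⸩) (n : ℤ) :
    ∃ P : Polynomial ℂ, ∀ L : ℝ, (evalLog L p).coeff n = P.eval (L : ℂ) := by
  induction p using Polynomial.induction_on' with
  | add p q hp hq =>
    obtain ⟨P, hP⟩ := hp
    obtain ⟨Q, hQ⟩ := hq
    exact ⟨P + Q, fun L => by rw [map_add, HahnSeries.coeff_add, hP, hQ, Polynomial.eval_add]⟩
  | monomial j s =>
    obtain ⟨N, c, hc⟩ := coeff_ofPowerSeries_mul (s := s) n
    refine ⟨∑ i ∈ Finset.range N, Polynomial.C (c i * ((j : ℂ) ^ i *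
      ((-1 / 2) ^ i * (1 / i.factorial : ℂ)))) * Polynomial.X ^ i, fun L => ?_⟩
    rw [evalLog_monomial, hc, Polynomial.eval_finsetSum]
    refine Finset.sum_congr rfl fun i _ => ?_
    rw [PowerSeries.coeff_rescale, coeff_expSeries]
    simp only [Polynomial.eval_mul, Polynomial.eval_C, Polynomial.eval_pow, Polynomial.eval_X]
    ring

theorem hasDerivAt_coeff_expSeries (L : ℝ) (n : ℕ) :
    HasDerivAt (fun L : ℝ => PowerSeries.coeff n (expSeries L))
      (PowerSeries.coeff n (PowerSeries.X * (PowerSeries.C (-1 / 2) * expSeries L))) L := by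
  simp only [coeff_expSeries]
  have h : HasDerivAt (fun L : ℝ => (L : ℂ) ^ n) (n * (L : ℂ) ^ (n - 1)) L := by
    simpa using (hasDerivAt_pow n (L : ℂ)).comp_ofReal
  refine (h.const_mul _).congr_deriv ?_
  rcases n with _ | n
  · simp
  · rw [PowerSeries.coeff_succ_X_mul, PowerSeries.coeff_C_mul, coeff_expSeries,
      Nat.factorial_succ]
    push_cast
    have : (n.factorial : ℂ) ≠ 0 := Nat.cast_ne_zero.2 n.factorial_ne_zero
    have : (n + 1 : ℂ) ≠ 0 := Nat.cast_add_one_ne_zero n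
    field_simp
    ring

theorem hasDerivAt_coeff_evalLog (p : Polynomial ℂ⸨X⸩) (n : ℤ) (L : ℝ) :
    HasDerivAt (fun L => (evalLog L p).coeff n)
      ((pairing (PowerSeries.X * (PowerSeries.C (-1 / 2) * expSeries L)) p).coeff n) L := by
  induction p using Polynomial.induction_on' with
  | add p q hp hq =>
    simp only [map_add, HahnSeries.coeff_add]
    exact hp.add hq
  | monomial j s =>
    obtain ⟨N, c, hc⟩ := coeff_ofPowerSeries_mul (s := s) n
    simp only [evalLog_monomial, pairing_monomial, hc, PowerSeries.coeff_rescale]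
    exact HasDerivAt.fun_sum fun i _ =>
      ((hasDerivAt_coeff_expSeries L i).const_mul _).const_mul _

/-- An exponential polynomial as a function of the momentum, `x` standing for
`(q² / μ²)^(-z / 2)`. -/
def toAmplitude (μ2 : Set.Ioi (0 : ℝ)) : Polynomial ℂ⸨X⸩ →+* Amplitude :=
  RingHom.pi fun q2 : Set.Ioi (0 : ℝ) => evalLog (Real.log (q2.1 / μ2.1))

theorem toAmplitude_apply (μ2 : Set.Ioi (0 : ℝ)) (p : Polynomial ℂ⸨X⸩) (q2 : Set.Ioi (0 : ℝ)) :
    toAmplitude μ2 p q2 = evalLog (Real.log (q2.1 / μ2.1)) p := rfl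

theorem toAmplitude_C (μ2 : Set.Ioi (0 : ℝ)) (a : ℂ⸨X⸩) :
    toAmplitude μ2 (Polynomial.C a) = fun _ => a :=
  funext fun q2 => by simp [toAmplitude_apply, evalLog]

theorem hasLogDeriv_toAmplitude (μ2 : Set.Ioi (0 : ℝ)) (p : Polynomial ℂ⸨X⸩) :
    HasLogDeriv μ2 (toAmplitude μ2 p) fun q2 => pairing (PowerSeries.X *
      (PowerSeries.C (-1 / 2) * expSeries (Real.log (q2.1 / μ2.1)))) p := by
  intro q2 n
  refine (hasDerivAt_coeff_evalLog p n _).congr_of_eventuallyEq (.of_forall fun L => ?_)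
  have h : μ2.1 * Real.exp L / μ2.1 = Real.exp L := mul_div_cancel_left₀ _ (ne_of_gt μ2.2)
  simp only [toAmplitude_apply, h, Real.log_exp]

/-- If all moments but the first one are free of poles, then the polar part does not depend on the
momentum. -/
theorem toAmplitude_sub_const_mem (μ2 : Set.Ioi (0 : ℝ)) {p : Polynomial ℂ⸨X⸩}
    (hp : ∀ h, pairing (PowerSeries.X * h) p ∈ regularSeries) (q2 : Set.Ioi (0 : ℝ)) :
    toAmplitude μ2 p q2 - p.eval 1 ∈ regularSeries := by
  -- Since `exp(-Lz/2)` has constant term `1`, it differs from the series `1`, whose pairing is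
  -- `p.eval 1`, by a multiple of `X`.
  have h0 : PowerSeries.constantCoeff (expSeries (Real.log (q2.1 / μ2.1))) = 1 := by
    rw [← PowerSeries.coeff_zero_eq_constantCoeff_apply, coeff_expSeries]
    simp
  rw [toAmplitude_apply, evalLog_eq_pairing, PowerSeries.eq_X_mul_shift_add_const (expSeries _), h0,
    pairing_add, map_one, pairing_one, add_sub_cancel_right]
  exact hp _

end ExpPoly

/-! ### The toy Feynman rules in closed form -/

theorem hasPowerSeriesSum_exp (c : ℂ) :
    HasPowerSeriesSum (fun z => Complex.exp (c * z)) (PowerSeries.rescale c (PowerSeries.exp ℂ)) := by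
  refine .of_forall fun z => ?_
  have h := NormedSpace.expSeries_div_hasSum_exp (𝔸 := ℂ) (c * z)
  rw [← Complex.exp_eq_exp_ℂ] at h
  refine h.congr_fun fun n => ?_
  rw [PowerSeries.coeff_rescale, PowerSeries.coeff_exp, mul_pow]
  simp only [one_div, map_inv₀, map_natCast]
  ring

theorem hasLaurentExpansion_const_mul_inv (b : ℂ) :
    HasLaurentExpansion (fun z => b * (z : ℂ)⁻¹) (HahnSeries.single (-1) b) := by
  refine .of_forall fun z => ?_
  have h := hasSum_single (f := fun n : ℤ => (HahnSeries.single (-1 : ℤ) b).coeff n * (z : ℂ) ^ n)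
    (-1) fun n hn => by rw [HahnSeries.coeff_single_of_ne hn, zero_mul]
  simpa using h

/-- The factor `π^(D/2)/Γ(D/2)` at `D/2 = 1 - z` is entire because `1/Γ` is. Its nonzero constant
term ensures that a one-vertex tree with `f c ≠ 0` has a genuine pole. -/
theorem exists_powerSeries_sphere : ∃ k : PowerSeries ℂ, PowerSeries.constantCoeff k ≠ 0 ∧
    HasPowerSeriesSum (fun z => ((Real.pi ^ (1 - z) / Real.Gamma (1 - z) : ℝ) : ℂ)) k := by
  have hG : AnalyticAt ℂ (fun w : ℂ => (Complex.Gamma (1 - w))⁻¹) 0 := by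
    have : Differentiable ℂ fun w : ℂ => (Complex.Gamma (1 - w))⁻¹ :=
      Complex.differentiable_one_div_Gamma.comp (by fun_prop : Differentiable ℂ fun w : ℂ => 1 - w)
    exact this.analyticAt 0
  have hE : AnalyticAt ℂ (fun w : ℂ => Complex.exp (Real.log Real.pi * (1 - w))) 0 := by
    fun_prop
  obtain ⟨k, hk0, hk⟩ := (hE.mul hG).exists_powerSeries
  refine ⟨k, ?_, ?_⟩
  · rw [hk0]
    simp [Complex.exp_ne_zero]
  · have := hk 1
    rw [Complex.ofReal_one, PowerSeries.rescale_one, RingHom.id_apply] at this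
    refine Filter.Eventually.mono this fun z hz => ?_
    convert hz using 1
    simp only [Pi.mul_apply]
    rw [one_mul, Real.rpow_def_of_pos Real.pi_pos]
    rw [div_eq_mul_inv]
    push_cast
    rw [← Complex.Gamma_ofReal]
    push_cast
    rfl

/-- This is the regular part of `Γ(s)Γ(1-s) = Γ(s+1)Γ(1-s)/s` at `s = cz`. -/
theorem exists_powerSeries_gamma : ∃ g : PowerSeries ℂ, PowerSeries.constantCoeff g = 1 ∧
    ∀ c : ℝ, HasPowerSeriesSum
      (fun z => ((Real.Gamma (c * z + 1) * Real.Gamma (1 - c * z) : ℝ) : ℂ))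
      (PowerSeries.rescale (c : ℂ) g) := by
  have hΓ : AnalyticAt ℂ Complex.Gamma 1 := by
    have : DifferentiableOn ℂ Complex.Gamma {w | 0 < w.re} := fun w hw =>
      (Complex.differentiableAt_Gamma w fun m hm => by
        rw [hm] at hw
        simp at hw
        exact absurd hw (by exact_mod_cast not_lt.2 (Nat.zero_le m))).differentiableWithinAt
    exact this.analyticAt ((isOpen_lt continuous_const Complex.continuous_re).mem_nhds (by simp))
  have h1 : AnalyticAt ℂ (fun w : ℂ => Complex.Gamma (w + 1)) 0 :=
    AnalyticAt.fun_comp (by simpa using hΓ) (by fun_prop)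
  have h2 : AnalyticAt ℂ (fun w : ℂ => Complex.Gamma (1 - w)) 0 :=
    AnalyticAt.fun_comp (by simpa using hΓ) (by fun_prop)
  obtain ⟨g, hg0, hg⟩ := (h1.mul h2).exists_powerSeries
  refine ⟨g, by simp [hg0], fun c => Filter.Eventually.mono (hg c) fun z hz => ?_⟩
  convert hz using 1
  simp only [Pi.mul_apply]
  push_cast
  rw [← Complex.Gamma_ofReal, ← Complex.Gamma_ofReal]
  push_cast
  rfl

section

variable {Dec : Type u}

theorem toyTree_node (deg : Dec → ℕ) (f : Dec → ℂ) (μ2 : ℝ) (c : Dec) (ts : Multiset (RTree Dec))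
    (q2 z : ℝ) : toyTree deg f μ2 (RTree.node c ts) q2 z =
      ((μ2 ^ (z * (deg c / 2)) : ℝ) : ℂ) * dimIntegral (2 - 2 * z) fun r =>
        f c * (ts.map fun t => toyTree deg f μ2 t r z).prod /
          ((r + q2 : ℝ) : ℂ) * ((r ^ (-z * (deg c / 2 - 1)) : ℝ) : ℂ) := by
  rw [toyTree, RTree.children_node, RTree.dec_node]
  congr 2
  funext r
  rw [Multiset.attach_map_val' ts fun t => toyTree deg f μ2 t r z]

/-- The toy Feynman rules as exponential polynomials, given by iterated grafting. -/
def toyPoly (deg : Dec → ℕ) (k : Dec → PowerSeries ℂ) (g : PowerSeries ℂ) (T : RTree Dec) :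
    Polynomial ℂ⸨X⸩ :=
  ExpPoly.graft (k T.dec) g (deg T.dec) (T.children.attach.map fun t => toyPoly deg k g t.1).prod
termination_by T
decreasing_by exact Relation.TransGen.single t.2

theorem toyPoly_node (deg : Dec → ℕ) (k : Dec → PowerSeries ℂ) (g : PowerSeries ℂ) (c : Dec)
    (ts : Multiset (RTree Dec)) : toyPoly deg k g (RTree.node c ts) =
      ExpPoly.graft (k c) g (deg c) (ts.map (toyPoly deg k g)).prod := by
  rw [toyPoly, RTree.children_node, RTree.dec_node, Multiset.attach_map_val' ts (toyPoly deg k g)]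

/-- The function `F` of the momentum and of the regulator is the exact power `(q² / μ²)^(-z n / 2)`
with a coefficient whose Laurent expansion is that of `p`. -/
def IsScaling (μ2 : ℝ) (p : Polynomial ℂ⸨X⸩) (F : ℝ → ℝ → ℂ) : Prop :=
  ∃ (n : ℕ) (a : ℂ⸨X⸩) (β : ℝ → ℂ), p = Polynomial.monomial n a ∧ HasLaurentExpansion β a ∧
    ∀ᶠ z in 𝓝[>] 0, ∀ q2 : ℝ, 0 < q2 → F q2 z = β z * (((q2 / μ2) ^ (-z * n / 2) : ℝ) : ℂ)

theorem isScaling_one (μ2 : ℝ) : IsScaling μ2 1 fun _ _ => 1 := by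
  refine ⟨0, 1, fun _ => 1, rfl, ?_, .of_forall fun z q2 _ => by simp⟩
  have h : HasPowerSeriesSum (fun _ => 1) 1 := .of_forall fun z => by
    have := hasSum_single (f := fun n : ℕ => PowerSeries.coeff n (1 : PowerSeries ℂ) * (z : ℂ) ^ n)
      0 fun n hn => by rw [PowerSeries.coeff_one, if_neg hn, zero_mul]
    simpa using this
  simpa using HasLaurentExpansion.of_powerSeries h

theorem IsScaling.mul {μ2 : ℝ} (hμ : 0 < μ2) {p q : Polynomial ℂ⸨X⸩} {F G : ℝ → ℝ → ℂ}
    (hF : IsScaling μ2 p F) (hG : IsScaling μ2 q G) :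
    IsScaling μ2 (p * q) fun q2 z => F q2 z * G q2 z := by
  obtain ⟨m, a, β, rfl, hβ, hm⟩ := hF
  obtain ⟨n, b, γ, rfl, hγ, hn⟩ := hG
  refine ⟨m + n, a * b, _, Polynomial.monomial_mul_monomial _ _ _ _, hβ.mul hγ, ?_⟩
  filter_upwards [hm, hn] with z h1 h2 q2 hq
  rw [h1 q2 hq, h2 q2 hq, show -z * (m + n : ℕ) / 2 = -z * m / 2 + -z * n / 2 by push_cast; ring,
    Real.rpow_add (div_pos hq hμ)]
  push_cast
  ring

theorem isScaling_multiset_prod {μ2 : ℝ} (hμ : 0 < μ2) {ι : Type*} {p : ι → Polynomial ℂ⸨X⸩}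
    {F : ι → ℝ → ℝ → ℂ} (s : Multiset ι) (h : ∀ i ∈ s, IsScaling μ2 (p i) (F i)) :
    IsScaling μ2 (s.map p).prod fun q2 z => (s.map fun i => F i q2 z).prod := by
  induction s using Multiset.induction_on with
  | empty => simpa using isScaling_one μ2
  | cons i s ih =>
    simp only [Multiset.map_cons, Multiset.prod_cons]
    exact (h i (Multiset.mem_cons_self i s)).mul hμ
      (ih fun j hj => h j (Multiset.mem_cons_of_mem hj))

/-- The powers of `r` from the branches, the vertex and the measure collect to `r^(-s)` with `s =
(n+d)z/2`. The Mellin integral gives `q2^(-s) Γ(s)Γ(1-s)`, and `Γ(s) = Γ(s+1)/s` isolates the pole.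
-/
theorem toyIntegral_eq {μ2 q2 z : ℝ} {d n : ℕ} (hμ : 0 < μ2) (hq : 0 < q2) (hz : 0 < z)
    (hd : 1 ≤ d) (h1 : ((d + n : ℕ) / 2 : ℝ) * z < 1) (f b : ℂ) {F : ℝ → ℂ}
    (hF : ∀ r, 0 < r → F r = b * (((r / μ2) ^ (-z * n / 2) : ℝ) : ℂ)) :
    ((μ2 ^ (z * (d / 2)) : ℝ) : ℂ) * dimIntegral (2 - 2 * z) (fun r =>
        f * F r / ((r + q2 : ℝ) : ℂ) * ((r ^ (-z * (d / 2 - 1)) : ℝ) : ℂ)) =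
      2 / (n + d : ℕ) * (z : ℂ)⁻¹ * (f * ((Real.pi ^ (1 - z) / Real.Gamma (1 - z) : ℝ) : ℂ) *
        ((Real.Gamma ((n + d : ℕ) / 2 * z + 1) * Real.Gamma (1 - (n + d : ℕ) / 2 * z) : ℝ) : ℂ)) *
          b * (((q2 / μ2) ^ (-z * (n + d : ℕ) / 2) : ℝ) : ℂ) := by
  have hv : (0 : ℝ) < (n + d : ℕ) := Nat.cast_pos.2 (by omega)
  set s : ℝ := (n + d : ℕ) / 2 * z with hs
  have hs0 : 0 < s := by positivity
  have hs1 : s < 1 := by rwa [hs, add_comm n d]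
  have hint : ∫ r in Set.Ioi (0 : ℝ), (f * F r / ((r + q2 : ℝ) : ℂ) *
      ((r ^ (-z * (d / 2 - 1)) : ℝ) : ℂ)) * ((r ^ ((2 - 2 * z) / 2 - 1) : ℝ) : ℂ) =
        f * b * ((μ2 ^ (z * n / 2) : ℝ) : ℂ) *
          ((q2 ^ (-s) * (Real.Gamma s * Real.Gamma (1 - s)) : ℝ) : ℂ) := by
    rw [← integral_rpow_div_add hq hs0 hs1, ← integral_const_mul]
    refine setIntegral_congr_fun measurableSet_Ioi fun r hr => ?_
    have hr' : 0 < r := hr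
    rw [hF r hr', show -s = -z * n / 2 + -z * (d / 2 - 1) + ((2 - 2 * z) / 2 - 1) by
      rw [hs]; push_cast; ring, Real.rpow_add hr', Real.rpow_add hr', Real.div_rpow hr'.le hμ.le,
      show -z * n / 2 = -(z * n / 2) by ring, Real.rpow_neg hμ.le]
    push_cast
    field_simp
  have hμs : μ2 ^ s = μ2 ^ (z * (d / 2)) * μ2 ^ (z * n / 2) := by
    rw [← Real.rpow_add hμ]
    congr 1
    rw [hs]
    push_cast
    ring
  have hone : 2 / ((n + d : ℕ) : ℂ) * (z : ℂ)⁻¹ * (s : ℂ) = 1 := by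
    have hz' : (z : ℂ) ≠ 0 := Complex.ofReal_ne_zero.2 hz.ne'
    have hv' : ((n + d : ℕ) : ℂ) ≠ 0 := Nat.cast_ne_zero.2 (by omega)
    rw [hs, Complex.ofReal_mul, Complex.ofReal_div, Complex.ofReal_natCast, Complex.ofReal_ofNat]
    field_simp
  rw [dimIntegral, hint, show -z * (n + d : ℕ) / 2 = -s by rw [hs]; ring,
    Real.div_rpow hq.le hμ.le, Real.rpow_neg hμ.le s, show (2 - 2 * z) / 2 = 1 - z by ring,
    Real.Gamma_add_one hs0.ne', hμs, div_inv_eq_mul]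
  generalize Real.Gamma s = Γ₁, Real.Gamma (1 - s) = Γ₂, q2 ^ (-s) = Q,
    Real.pi ^ (1 - z) / Real.Gamma (1 - z) = S, μ2 ^ (z * (d / 2)) = A, μ2 ^ (z * n / 2) = B
  simp only [Complex.ofReal_mul]
  linear_combination (-(f * S * Γ₁ * Γ₂ * b * Q * A * B) : ℂ) * hone

theorem isScaling_toyTree (deg : Dec → ℕ) (hdeg : ∀ c, 1 ≤ deg c) (f : Dec → ℂ) {μ2 : ℝ}
    (hμ : 0 < μ2) {k g : PowerSeries ℂ}
    (hk : HasPowerSeriesSum (fun z => ((Real.pi ^ (1 - z) / Real.Gamma (1 - z) : ℝ) : ℂ)) k)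
    (hg : ∀ c : ℝ, HasPowerSeriesSum
      (fun z => ((Real.Gamma (c * z + 1) * Real.Gamma (1 - c * z) : ℝ) : ℂ))
      (PowerSeries.rescale (c : ℂ) g)) (T : RTree Dec) :
    IsScaling μ2 (toyPoly deg (fun c => PowerSeries.C (f c) * k) g T) (toyTree deg f μ2 T) := by
  induction T using RTree.induction with
  | h c ts ih =>
    obtain ⟨n, a, β, hp, hβ, hF⟩ := isScaling_multiset_prod hμ ts ih
    rw [toyPoly_node, hp, ExpPoly.graft_monomial]
    have hf : HasPowerSeriesSum (fun _ => f c) (PowerSeries.C (f c)) := .of_forall fun z => by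
      have := hasSum_single
        (f := fun n : ℕ => PowerSeries.coeff n (PowerSeries.C (f c)) * (z : ℂ) ^ n)
        0 fun n hn => by rw [PowerSeries.coeff_C, if_neg hn, zero_mul]
      simpa using this
    have hexp := (hf.mul hk).mul (hg ((n + deg c : ℕ) / 2))
    rw [show (((n + deg c : ℕ) / 2 : ℝ) : ℂ) = ((n + deg c : ℕ) : ℂ) / 2 by push_cast; rfl] at hexp
    refine ⟨_, _, _, rfl, ((hasLaurentExpansion_const_mul_inv _).mul
      (.of_powerSeries hexp)).mul hβ, ?_⟩
    -- This is convergence, `s < 1`. How small `z` must be depends on the tree but not on `q²`, so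
    -- the formula for the branches holds under the whole integral.
    have hlim : ∀ᶠ z : ℝ in 𝓝[>] 0, ((deg c + n : ℕ) / 2 : ℝ) * z < 1 := by
      have ht : Tendsto (fun z : ℝ => ((deg c + n : ℕ) / 2 : ℝ) * z) (𝓝[>] 0) (𝓝 0) :=
        ((by fun_prop : Continuous fun z : ℝ => ((deg c + n : ℕ) / 2 : ℝ) * z).tendsto' 0 0
          (by simp)).mono_left nhdsWithin_le_nhds
      exact ht.eventually_lt_const one_pos
    filter_upwards [hF, hlim, self_mem_nhdsWithin] with z hz h1 h0 q2 hq
    rw [toyTree_node]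
    exact toyIntegral_eq hμ hq h0 (hdeg c) h1 (f c) (β z) fun r hr => hz r hr

theorem IsScaling.laurentExpansion_eq {μ2 : Set.Ioi (0 : ℝ)} {p : Polynomial ℂ⸨X⸩}
    {F : ℝ → ℝ → ℂ} (h : IsScaling μ2.1 p F) (q2 : Set.Ioi (0 : ℝ)) :
    laurentExpansion (F q2.1) = ExpPoly.toAmplitude μ2 p q2 := by
  obtain ⟨n, a, β, rfl, hβ, hF⟩ := h
  have hpos : 0 < q2.1 / μ2.1 := div_pos q2.2 μ2.2
  have hexp := HasLaurentExpansion.of_powerSeries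
    (hasPowerSeriesSum_exp (-Real.log (q2.1 / μ2.1) / 2 * n))
  rw [ExpPoly.toAmplitude_apply, ExpPoly.evalLog_monomial, ExpPoly.expSeries,
    PowerSeries.rescale_rescale]
  refine ((hexp.mul hβ).congr ?_).laurentExpansion_eq
  filter_upwards [hF] with z hz
  rw [hz q2.1 q2.2, Real.rpow_def_of_pos hpos, mul_comm]
  push_cast
  congr 2
  ring

theorem toyFeynmanRules_ofTree (deg : Dec → ℕ) (hdeg : ∀ c, 1 ≤ deg c) (f : Dec → ℂ)
    (μ2 : Set.Ioi (0 : ℝ)) : ∃ k g : PowerSeries ℂ, PowerSeries.constantCoeff k ≠ 0 ∧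
      PowerSeries.constantCoeff g = 1 ∧ ∀ T : RTree Dec,
        toyFeynmanRules deg f μ2 (TreeAlg.ofTree T) =
          ExpPoly.toAmplitude μ2 (toyPoly deg (fun c => PowerSeries.C (f c) * k) g T) := by
  obtain ⟨k, hk0, hk⟩ := exists_powerSeries_sphere
  obtain ⟨g, hg0, hg⟩ := exists_powerSeries_gamma
  refine ⟨k, g, hk0, hg0, fun T => ?_⟩
  exact (MvPolynomial.aeval_X _ T).trans (funext fun q2 =>
    (isScaling_toyTree deg hdeg f μ2.2 hk hg T).laurentExpansion_eq q2)

end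

/-! ### Counterterms as sums over admissible cuts -/

namespace TreeAlg

variable {Dec : Type u} {V : Type*} [CommRing V] [Algebra ℂ V]

theorem counterterm_ofForest (R : V →ₗ[ℂ] V) (φ : TreeAlg Dec →ₐ[ℂ] V) (F : Multiset (RTree Dec)) :
    counterterm R φ (ofForest F) = (F.map (countertermTree R φ)).prod := by
  rw [ofForest, map_multiset_prod, Multiset.map_map]
  congr 1
  exact Multiset.map_congr rfl fun t _ => MvPolynomial.aeval_X _ t

theorem bogoliubov_ofTree (R : V →ₗ[ℂ] V) (φ : TreeAlg Dec →ₐ[ℂ] V) (T : RTree Dec) :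
    bogoliubov R φ (ofTree T) =
      (T.cuts.map fun C => (C.1.map (countertermTree R φ)).prod * φ (ofTree C.2)).sum := by
  have hP1 : augProj (1 : TreeAlg Dec) = 0 := by simp [augProj]
  have hPX : ∀ t : RTree Dec, augProj (ofTree t) = ofTree t := fun t => by
    simp [augProj, counit]
  simp only [bogoliubov, coproduct, LinearMap.comp_apply, AlgHom.toLinearMap_apply,
    MvPolynomial.aeval_X, map_add, LinearMap.lTensor_tmul, hP1, TensorProduct.tmul_zero,
    map_multiset_sum, Multiset.map_map, Function.comp_def, hPX, zero_add,
    Algebra.TensorProduct.lift_tmul, counterterm_ofForest]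

theorem countertermTree_eq (R : V →ₗ[ℂ] V) (φ : TreeAlg Dec →ₐ[ℂ] V) (T : RTree Dec) :
    countertermTree R φ T = -R (bogoliubov R φ (ofTree T)) := by
  rw [← counterterm_ofTree, counterterm, MvPolynomial.aeval_X]

theorem renormalized_ofTree (R : V →ₗ[ℂ] V) (φ : TreeAlg Dec →ₐ[ℂ] V) (T : RTree Dec) :
    renormalized R φ (ofTree T) = countertermTree R φ T + bogoliubov R φ (ofTree T) := by
  have hT : counterterm R φ (ofTree T) = countertermTree R φ T := MvPolynomial.aeval_X _ T
  rw [bogoliubov_ofTree]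
  simp only [renormalized, convolution, coproduct, AlgHom.comp_apply, MvPolynomial.aeval_X, map_add,
    map_multiset_sum, Multiset.map_map, Function.comp_def, Algebra.TensorProduct.lift_tmul, map_one,
    mul_one, counterterm_ofForest, hT]

end TreeAlg

theorem Multiset.sum_map_prod_map_sections {α β : Type*} [CommSemiring β] (w : α → β)
    (m : Multiset (Multiset α)) :
    ((Multiset.Sections m).map fun σ => (σ.map w).prod).sum =
      (m.map fun l => (l.map w).sum).prod := by
  induction m using Multiset.induction_on with
  | empty => simp
  | cons l m ih =>
    rw [Multiset.sections_cons, Multiset.map_cons, Multiset.prod_cons, ← ih, Multiset.map_bind,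
      Multiset.sum_bind, ← Multiset.sum_map_mul_right]
    refine congrArg _ (Multiset.map_congr rfl fun a _ => ?_)
    rw [Multiset.map_map, ← Multiset.sum_map_mul_left]
    simp

/-! ### Cuts and grafting with momentum independent counterterms -/

section

variable {Dec : Type u} (deg : Dec → ℕ) (k : Dec → PowerSeries ℂ) (g : PowerSeries ℂ)
  (s : RTree Dec → ℂ⸨X⸩)

/-- The Bogoliubov operation, for counterterms `s` that do not depend on the momentum. -/
def bogoliubovPoly (T : RTree Dec) : Polynomial ℂ⸨X⸩ :=
  (T.cuts.map fun C => Polynomial.C (C.1.map s).prod * toyPoly deg k g C.2).sum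

/-- The renormalized value of a tree, for counterterms `s` that do not depend on the momentum. -/
def renormalizedPoly (T : RTree Dec) : Polynomial ℂ⸨X⸩ :=
  Polynomial.C (s T) + bogoliubovPoly deg k g s T

/-- Grafting is a Hochschild cocycle. -/
theorem bogoliubovPoly_node (c : Dec) (ts : Multiset (RTree Dec)) :
    bogoliubovPoly deg k g s (RTree.node c ts) =
      ExpPoly.graft (k c) g (deg c) (ts.map (renormalizedPoly deg k g s)).prod := by
  -- A branch is either pruned whole, contributing `s t`, or cut further, contributing a term of
  -- `bogoliubovPoly`; together these give its renormalized value.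
  have hw : ∀ t : RTree Dec, ((((({t} : Multiset (RTree Dec)), (0 : Multiset (RTree Dec))) ::ₘ
      (RTree.cuts t).map fun C => (C.1, ({C.2} : Multiset (RTree Dec))))).map fun x =>
        Polynomial.C (x.1.map s).prod * (x.2.map (toyPoly deg k g)).prod).sum =
          renormalizedPoly deg k g s t := fun t => by
    simp [renormalizedPoly, bogoliubovPoly, Multiset.map_map]
  have hprod := Multiset.sum_map_prod_map_sections
    (fun x : Multiset (RTree Dec) × Multiset (RTree Dec) =>
      Polynomial.C (x.1.map s).prod * (x.2.map (toyPoly deg k g)).prod)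
    (ts.map fun t => ((({t} : Multiset (RTree Dec)), (0 : Multiset (RTree Dec))) ::ₘ
      (RTree.cuts t).map fun C => (C.1, ({C.2} : Multiset (RTree Dec)))))
  rw [Multiset.map_map] at hprod
  simp only [Function.comp_def, hw] at hprod
  rw [← hprod, map_multiset_sum, Multiset.map_map, bogoliubovPoly, RTree.cuts_node, Multiset.map_map]
  refine congrArg _ (Multiset.map_congr rfl fun σ _ => ?_)
  have hσ : ∀ σ : Multiset (Multiset (RTree Dec) × Multiset (RTree Dec)),
      (σ.map fun x => Polynomial.C (x.1.map s).prod * (x.2.map (toyPoly deg k g)).prod).prod =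
      Polynomial.C ((σ.map Prod.fst).sum.map s).prod *
        ((σ.map Prod.snd).sum.map (toyPoly deg k g)).prod := by
    intro σ
    induction σ using Multiset.induction_on with
    | empty => simp
    | cons x σ ih =>
      simp only [Multiset.map_cons, Multiset.prod_cons, Multiset.sum_cons, Multiset.map_add,
        Multiset.prod_add, map_mul, ih]
      ring
  simp only [Function.comp_apply, hσ]
  -- Counterterms are scalars for the linear operator `graft`, so they pass through it.
  rw [toyPoly_node, ← Polynomial.smul_eq_C_mul, ← Polynomial.smul_eq_C_mul, map_smul]

end

/-! ### Momentum independent subtractions -/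

/-- A Laurent series as an amplitude that does not depend on the momentum. -/
def constAmplitude (a : ℂ⸨X⸩) : Amplitude := fun _ => a

theorem constAmplitude_smul (r : ℂ) (a : ℂ⸨X⸩) :
    constAmplitude (HahnSeries.C r * a) = r • constAmplitude a := by
  rw [Algebra.smul_def]
  rfl

/-- The action of a local scheme on Laurent series that do not depend on the momentum. -/
def constScheme (μ2 : Set.Ioi (0 : ℝ)) (R : Amplitude →ₗ[ℂ] Amplitude) : ℂ⸨X⸩ →+ ℂ⸨X⸩ where
  toFun a := R (constAmplitude a) μ2
  map_zero' := congrFun (map_zero R) μ2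
  map_add' a b := congrFun (map_add R (constAmplitude a) (constAmplitude b)) μ2

section

variable {μ2 : Set.Ioi (0 : ℝ)} {R : Amplitude →ₗ[ℂ] Amplitude}

theorem IsLocalScheme.apply_const (hloc : IsLocalScheme R) (a : ℂ⸨X⸩) :
    R (constAmplitude a) = constAmplitude (constScheme μ2 R a) := by
  obtain ⟨b, hb⟩ := hloc.1 a
  have h : constScheme μ2 R a = b := congrFun hb μ2
  rw [h]
  exact hb

theorem IsLocalScheme.apply_regular (hloc : IsLocalScheme R) {F : Amplitude}
    (hF : ∀ q2, F q2 ∈ regularSeries) : ∃ b ∈ regularSeries, R F = constAmplitude b := by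
  obtain ⟨b, hb, h⟩ := hloc.2 F fun q2 => exists_hasLimitAtZero_iff.2 (hF q2)
  exact ⟨b, exists_hasLimitAtZero_iff.1 hb, h⟩

theorem IsLocalScheme.constScheme_mem (hloc : IsLocalScheme R) {a : ℂ⸨X⸩}
    (ha : a ∈ regularSeries) : constScheme μ2 R a ∈ regularSeries := by
  obtain ⟨b, hb, h⟩ := hloc.apply_regular (F := constAmplitude a) fun _ => ha
  have : constScheme μ2 R a = b := congrFun h μ2
  rwa [this]

theorem constScheme_C_mul (r : ℂ) (a : ℂ⸨X⸩) :
    constScheme μ2 R (HahnSeries.C r * a) = HahnSeries.C r * constScheme μ2 R a := by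
  have h := congrFun (map_smul R r (constAmplitude a)) μ2
  rw [← constAmplitude_smul, Algebra.smul_def] at h
  exact h

theorem IsRotaBaxter.constScheme_mul (hRB : IsRotaBaxter R) (hloc : IsLocalScheme R)
    (a b : ℂ⸨X⸩) : constScheme μ2 R (a * b) + constScheme μ2 R a * constScheme μ2 R b =
      constScheme μ2 R (constScheme μ2 R a * b) + constScheme μ2 R (a * constScheme μ2 R b) := by
  have h := hRB (constAmplitude a) (constAmplitude b)
  rw [hloc.apply_const (μ2 := μ2) a, hloc.apply_const (μ2 := μ2) b] at h
  exact congrFun h μ2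

/-- A Rota–Baxter operator on Laurent series that removes the pole of one series with a simple pole
removes all poles. -/
theorem sub_constScheme_mem (hRB : IsRotaBaxter R) (hloc : IsLocalScheme R) {u : ℂ⸨X⸩}
    {q : PowerSeries ℂ} (hq : PowerSeries.constantCoeff q ≠ 0)
    (hu : HahnSeries.ofPowerSeries ℤ ℂ PowerSeries.X * u = HahnSeries.ofPowerSeries ℤ ℂ q)
    (hQU : u - constScheme μ2 R u ∈ regularSeries) (a : ℂ⸨X⸩) :
    a - constScheme μ2 R a ∈ regularSeries := by
  set z : ℂ⸨X⸩ := HahnSeries.ofPowerSeries ℤ ℂ PowerSeries.X with hz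
  have hz0 : z ≠ 0 := by
    rw [hz, HahnSeries.ofPowerSeries_X]
    exact HahnSeries.single_ne_zero one_ne_zero
  have hreg : ∀ a ∈ regularSeries, a - constScheme μ2 R a ∈ regularSeries := fun a ha =>
    sub_mem ha (hloc.constScheme_mem ha)
  have hsimple : ∀ a, z * a ∈ regularSeries → a - constScheme μ2 R a ∈ regularSeries := by
    rintro a ⟨p, hp⟩
    -- With this ratio of residues, `a - r u` has no pole.
    set r := PowerSeries.constantCoeff p / PowerSeries.constantCoeff q with hr
    have hb : a - HahnSeries.C r * u ∈ regularSeries := by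
      have h0 : PowerSeries.constantCoeff (p - PowerSeries.C r * q) = 0 := by
        rw [map_sub, map_mul, PowerSeries.constantCoeff_C, hr, div_mul_cancel₀ _ hq, sub_self]
      obtain ⟨t, ht⟩ := PowerSeries.X_dvd_iff.2 h0
      refine ⟨t, mul_left_cancel₀ hz0 ?_⟩
      rw [hz, ← map_mul, ← ht, map_sub, hp, map_mul, ← hu, HahnSeries.ofPowerSeries_C]
      ring
    have e : a - constScheme μ2 R a = (a - HahnSeries.C r * u -
        constScheme μ2 R (a - HahnSeries.C r * u)) +
          HahnSeries.C r * (u - constScheme μ2 R u) := by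
      rw [map_sub, constScheme_C_mul]
      ring
    rw [e]
    refine add_mem (hreg _ hb) (mul_mem ?_ hQU)
    rw [← HahnSeries.ofPowerSeries_C]
    exact ofPowerSeries_mem_regularSeries _
  -- Induction on the pole order, at most `n + 1`, starting from simple poles.
  have hall : ∀ n : ℕ, ∀ a, z ^ (n + 1) * a ∈ regularSeries →
      a - constScheme μ2 R a ∈ regularSeries := by
    intro n
    induction n with
    | zero => simpa using hsimple
    | succ n ih =>
      intro a ha
      have hinv : HahnSeries.ofPowerSeries ℤ ℂ q * HahnSeries.ofPowerSeries ℤ ℂ q⁻¹ = 1 := by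
        rw [← map_mul, PowerSeries.mul_inv_cancel q hq, map_one]
      -- Since `z u = q` with `q` invertible, this is `a / u`; its pole order is lower by one.
      set b := z * HahnSeries.ofPowerSeries ℤ ℂ q⁻¹ * a with hb
      have hub : u * b = a := by
        rw [hb, show u * (z * HahnSeries.ofPowerSeries ℤ ℂ q⁻¹ * a) =
          (z * u) * HahnSeries.ofPowerSeries ℤ ℂ q⁻¹ * a by ring, hu, hinv, one_mul]
      have hzb : z ^ (n + 1) * b ∈ regularSeries := by
        rw [hb, show z ^ (n + 1) * (z * HahnSeries.ofPowerSeries ℤ ℂ q⁻¹ * a) =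
          HahnSeries.ofPowerSeries ℤ ℂ q⁻¹ * (z ^ (n + 1 + 1) * a) by ring]
        exact mul_mem (ofPowerSeries_mem_regularSeries _) ha
      have hβ := ih b hzb
      have h1 : (u - constScheme μ2 R u) * b -
          constScheme μ2 R ((u - constScheme μ2 R u) * b) ∈ regularSeries := by
        refine ih _ ?_
        rw [mul_left_comm]
        exact mul_mem hQU hzb
      have h2 : u * (b - constScheme μ2 R b) -
          constScheme μ2 R (u * (b - constScheme μ2 R b)) ∈ regularSeries := by
        refine hsimple _ ?_
        rw [← mul_assoc, hu]
        exact mul_mem (ofPowerSeries_mem_regularSeries _) hβ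
      have hrb := hRB.constScheme_mul (μ2 := μ2) hloc u b
      -- With `Q = id - R`, which is again Rota–Baxter, this reads `Q(ub) = Q(Q(u) b) + Q(u Q(b)) -
      -- Q(u) Q(b)`.
      have e : a - constScheme μ2 R a =
          ((u - constScheme μ2 R u) * b - constScheme μ2 R ((u - constScheme μ2 R u) * b)) +
            (u * (b - constScheme μ2 R b) - constScheme μ2 R (u * (b - constScheme μ2 R b))) -
              (u - constScheme μ2 R u) * (b - constScheme μ2 R b) := by
        rw [← hub, sub_mul, mul_sub u, map_sub, map_sub]
        linear_combination hrb
      rw [e]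
      exact sub_mem (add_mem h1 h2) (mul_mem hQU hβ)
  obtain ⟨N, hN⟩ := exists_ofPowerSeries_X_pow_mul_mem a
  refine hall N a ?_
  rw [hz, ← map_pow]
  exact hN (N + 1) (Nat.le_succ N)

/-- The amplitude is its value at `q² = μ²` plus a regular amplitude; the two clauses of locality
treat these summands. -/
theorem IsLocalScheme.apply_toAmplitude (hloc : IsLocalScheme R) {p : Polynomial ℂ⸨X⸩}
    (hp : ∀ h, ExpPoly.pairing (PowerSeries.X * h) p ∈ regularSeries) :
    ∃ ρ ∈ regularSeries, R (ExpPoly.toAmplitude μ2 p) =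
      constAmplitude (constScheme μ2 R (p.eval 1) + ρ) := by
  obtain ⟨ρ, hρ, h⟩ := hloc.apply_regular
    (F := ExpPoly.toAmplitude μ2 p - constAmplitude (p.eval 1))
    (ExpPoly.toAmplitude_sub_const_mem μ2 hp)
  refine ⟨ρ, hρ, ?_⟩
  rw [map_sub, hloc.apply_const (μ2 := μ2), sub_eq_iff_eq_add] at h
  rw [h, add_comm]
  rfl

/-! ### Renormalization of the toy model -/

variable {Dec : Type u} {deg : Dec → ℕ} {f : Dec → ℂ} {k g : PowerSeries ℂ}
  {φ : TreeAlg Dec →ₐ[ℂ] Amplitude}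

/-- Agreement with the poles at `q² = μ²` on a single one-vertex tree already makes the scheme subtract
all poles of momentum independent series. -/
theorem sub_constScheme_mem_of_oneVertex (hdeg : ∀ c, 1 ≤ deg c) (hRB : IsRotaBaxter R)
    (hloc : IsLocalScheme R) (hk : PowerSeries.constantCoeff k ≠ 0)
    (hg : PowerSeries.constantCoeff g = 1)
    (hφ : ∀ T, φ (TreeAlg.ofTree T) =
      ExpPoly.toAmplitude μ2 (toyPoly deg (fun c => PowerSeries.C (f c) * k) g T))
    (hassum : ∀ X, ∃ l : ℂ, HasLimitAtZero ((φ X - R (φ X)) μ2) l) {c : Dec} (hc : f c ≠ 0)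
    (a : ℂ⸨X⸩) : a - constScheme μ2 R a ∈ regularSeries := by
  set p := ExpPoly.graft (PowerSeries.C (f c) * k) g (deg c) (Polynomial.monomial 0 1) with hp
  have hφc : φ (TreeAlg.ofTree (RTree.node c 0)) = ExpPoly.toAmplitude μ2 p := by
    rw [hφ, toyPoly_node, Multiset.map_zero, Multiset.prod_zero]
    rfl
  have hmem : ∀ h, ExpPoly.pairing (PowerSeries.X * h) p ∈ regularSeries :=
    ExpPoly.pairing_X_mul_graft_mem _ _ (hdeg c) (ExpPoly.isFinite_monomial_one 0)
  obtain ⟨ρ, hρ, hR⟩ := hloc.apply_toAmplitude (μ2 := μ2) hmem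
  have hd : ((0 + deg c : ℕ) : ℂ) ≠ 0 := Nat.cast_ne_zero.2 (by have := hdeg c; omega)
  -- This is `z` times the one-vertex amplitude at `q² = μ²`, whose pole there is simple.
  set q := PowerSeries.C (2 / ((0 + deg c : ℕ) : ℂ)) * ((PowerSeries.C (f c) * k) *
    PowerSeries.rescale (((0 + deg c : ℕ) : ℂ) / 2) g) with hqdef
  have hq : PowerSeries.constantCoeff q ≠ 0 := by
    have hg' : PowerSeries.constantCoeff
        (PowerSeries.rescale (((0 + deg c : ℕ) : ℂ) / 2) g) = 1 := by
      rw [← PowerSeries.coeff_zero_eq_constantCoeff_apply, PowerSeries.coeff_rescale, pow_zero,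
        one_mul, PowerSeries.coeff_zero_eq_constantCoeff_apply, hg]
    rw [hqdef, map_mul, map_mul, map_mul, hg', PowerSeries.constantCoeff_C,
      PowerSeries.constantCoeff_C, mul_one]
    exact mul_ne_zero (div_ne_zero two_ne_zero hd) (mul_ne_zero hc hk)
  refine sub_constScheme_mem hRB hloc (u := p.eval 1) hq ?_ ?_ a
  · rw [hp, ExpPoly.graft_monomial, Polynomial.eval_monomial, one_pow, mul_one, mul_one, ← mul_assoc,
      hqdef, map_mul _ (PowerSeries.C _), HahnSeries.ofPowerSeries_X, HahnSeries.ofPowerSeries_C,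
      HahnSeries.single_mul_single, one_mul, HahnSeries.C_apply]
    congr 1
  · have h := exists_hasLimitAtZero_iff.1 (hassum (TreeAlg.ofTree (RTree.node c 0)))
    rw [hφc, hR] at h
    have h1 := ExpPoly.toAmplitude_sub_const_mem μ2 hmem μ2
    have e : p.eval 1 - constScheme μ2 R (p.eval 1) =
        (ExpPoly.toAmplitude μ2 p - constAmplitude (constScheme μ2 R (p.eval 1) + ρ)) μ2 -
          (ExpPoly.toAmplitude μ2 p μ2 - p.eval 1) + ρ := by
      change _ = ExpPoly.toAmplitude μ2 p μ2 - (constScheme μ2 R (p.eval 1) + ρ) -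
          (ExpPoly.toAmplitude μ2 p μ2 - p.eval 1) + ρ
      ring
    rw [e]
    exact add_mem (sub_mem h h1) hρ

theorem bogoliubov_eq_toAmplitude {kf : Dec → PowerSeries ℂ}
    (hφ : ∀ T, φ (TreeAlg.ofTree T) = ExpPoly.toAmplitude μ2 (toyPoly deg kf g T))
    {s : RTree Dec → ℂ⸨X⸩} {T : RTree Dec}
    (hs : ∀ t, Relation.TransGen RTree.IsChild t T →
      TreeAlg.countertermTree R φ t = constAmplitude (s t)) :
    TreeAlg.bogoliubov R φ (TreeAlg.ofTree T) =
      ExpPoly.toAmplitude μ2 (bogoliubovPoly deg kf g s T) := by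
  rw [TreeAlg.bogoliubov_ofTree, bogoliubovPoly, map_multiset_sum, Multiset.map_map]
  refine congrArg _ (Multiset.map_congr rfl fun C hC => ?_)
  rw [Function.comp_apply, map_mul, hφ, map_multiset_prod, map_multiset_prod, Multiset.map_map,
    Multiset.map_map]
  congr 2
  refine Multiset.map_congr rfl fun t ht => ?_
  rw [hs t (RTree.transGen_of_mem_cuts T C hC t ht)]
  exact (ExpPoly.toAmplitude_C μ2 (s t)).symm

theorem pairing_X_mul_bogoliubovPoly_mem (hdeg : ∀ c, 1 ≤ deg c) {kf : Dec → PowerSeries ℂ}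
    {s : RTree Dec → ℂ⸨X⸩} {T : RTree Dec}
    (hT : ∀ t, RTree.IsChild t T → ExpPoly.IsFinite (renormalizedPoly deg kf g s t))
    (h : PowerSeries ℂ) :
    ExpPoly.pairing (PowerSeries.X * h) (bogoliubovPoly deg kf g s T) ∈ regularSeries := by
  rw [← RTree.node_dec_children T, bogoliubovPoly_node]
  refine ExpPoly.pairing_X_mul_graft_mem _ _ (hdeg _) (ExpPoly.isFinite_multiset_prod _ ?_) h
  intro p hp
  obtain ⟨t, ht, rfl⟩ := Multiset.mem_map.1 hp
  exact hT t ht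

/-- Counterterms do not depend on the momentum, and renormalized trees have no poles. -/
theorem counterterm_const_and_isFinite (hdeg : ∀ c, 1 ≤ deg c) (hloc : IsLocalScheme R)
    (hφ : ∀ T, φ (TreeAlg.ofTree T) =
      ExpPoly.toAmplitude μ2 (toyPoly deg (fun c => PowerSeries.C (f c) * k) g T))
    (hsub : ∀ c, f c ≠ 0 → ∀ a, a - constScheme μ2 R a ∈ regularSeries)
    {s : RTree Dec → ℂ⸨X⸩} (hs : ∀ T, s T = TreeAlg.countertermTree R φ T μ2) (T : RTree Dec) :
    TreeAlg.countertermTree R φ T = constAmplitude (s T) ∧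
      ExpPoly.IsFinite (renormalizedPoly deg (fun c => PowerSeries.C (f c) * k) g s T) := by
  -- The induction runs over all proper subtrees, because cuts may prune trees deep below the root.
  induction T using RTree.isChild_wf.transGen.induction with
  | h T ih =>
    set b := bogoliubovPoly deg (fun c => PowerSeries.C (f c) * k) g s T with hb
    have hbog := bogoliubov_eq_toAmplitude (T := T) hφ fun t ht => (ih t ht).1
    have hmem := pairing_X_mul_bogoliubovPoly_mem (T := T) hdeg fun t ht => (ih t (.single ht)).2
    obtain ⟨ρ, hρ, hR⟩ := hloc.apply_toAmplitude (μ2 := μ2) hmem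
    rw [← hb] at hbog hmem hR
    have hct : TreeAlg.countertermTree R φ T =
        constAmplitude (-(constScheme μ2 R (b.eval 1) + ρ)) := by
      rw [TreeAlg.countertermTree_eq, hbog, hR]
      rfl
    have hsT : s T = -(constScheme μ2 R (b.eval 1) + ρ) := by
      rw [hs, hct]
      rfl
    refine ⟨by rw [hct, hsT], fun n => ?_⟩
    rw [renormalizedPoly, ← hb, map_add]
    rcases n with _ | n
    · have hsubb : b.eval 1 - constScheme μ2 R (b.eval 1) ∈ regularSeries := by
        -- If the root constant vanishes, there is nothing to subtract; otherwise the one-vertex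
        -- tree with this decoration shows that the scheme removes poles.
        by_cases hc : f T.dec = 0
        · have hb0 : b = 0 := by
            rw [hb, ← RTree.node_dec_children T, bogoliubovPoly_node, hc, map_zero, zero_mul,
              ExpPoly.graft_zero]
          simp [hb0]
        · exact hsub _ hc _
      rw [pow_zero, ExpPoly.pairing_one, ExpPoly.pairing_one, Polynomial.eval_C, hsT,
        show -(constScheme μ2 R (b.eval 1) + ρ) + b.eval 1 =
          b.eval 1 - constScheme μ2 R (b.eval 1) - ρ by ring]
      exact sub_mem hsubb hρ
    -- The Euler operator kills the counterterm, a constant in `x`, so positive moments are those of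
    -- the Bogoliubov operation.
    · rw [pow_succ', ExpPoly.pairing_X_mul _ (Polynomial.C _), ExpPoly.euler,
        Polynomial.derivative_C, mul_zero, mul_zero, map_zero, zero_add]
      exact hmem _

end

end

theorem theorem1 {Dec : Type*} (deg : Dec → ℕ) (hdeg : ∀ c, 1 ≤ deg c) (f : Dec → ℂ)
    (μ2 : Set.Ioi (0 : ℝ)) (R : Amplitude →ₗ[ℂ] Amplitude)
    (hRB : IsRotaBaxter R) (hloc : IsLocalScheme R)
    (hassum : ∀ X : TreeAlg Dec, ∃ l : ℂ,
      HasLimitAtZero ((toyFeynmanRules deg f μ2 X - R (toyFeynmanRules deg f μ2 X)) μ2) l)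
    (T : RTree Dec) :
    (∃ p : Polynomial ℂ, ∀ q2 : Set.Ioi (0 : ℝ),
      HasLimitAtZero (TreeAlg.renormalized R (toyFeynmanRules deg f μ2) (TreeAlg.ofTree T) q2)
        (p.eval ((Real.log (q2.1 / μ2.1) : ℝ) : ℂ))) ∧
    ∃ G : Amplitude,
      HasLogDeriv μ2 (TreeAlg.bogoliubov R (toyFeynmanRules deg f μ2) (TreeAlg.ofTree T)) G ∧
      ∀ q2 : Set.Ioi (0 : ℝ), ∃ l : ℂ, HasLimitAtZero (G q2) l := by
  obtain ⟨k, g, hk, hg, hφ⟩ := toyFeynmanRules_ofTree deg hdeg f μ2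
  -- The candidates for the constant counterterms are their values at `q² = μ²`.
  have main := counterterm_const_and_isFinite hdeg hloc hφ
    (fun c hc => sub_constScheme_mem_of_oneVertex hdeg hRB hloc hk hg hφ hassum hc) fun _ => rfl
  have hbog := bogoliubov_eq_toAmplitude (T := T) hφ fun t _ => (main t).1
  constructor
  · have hren : TreeAlg.renormalized R (toyFeynmanRules deg f μ2) (TreeAlg.ofTree T) =
        ExpPoly.toAmplitude μ2 (renormalizedPoly deg (fun c => PowerSeries.C (f c) * k) g
          (fun T => TreeAlg.countertermTree R (toyFeynmanRules deg f μ2) T μ2) T) := by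
      rw [TreeAlg.renormalized_ofTree, hbog, (main T).1, renormalizedPoly, map_add,
        ExpPoly.toAmplitude_C]
      rfl
    obtain ⟨P, hP⟩ := ExpPoly.exists_polynomial_coeff_evalLog
      (renormalizedPoly deg (fun c => PowerSeries.C (f c) * k) g
          (fun T => TreeAlg.countertermTree R (toyFeynmanRules deg f μ2) T μ2) T) 0
    refine ⟨P, fun q2 => ?_⟩
    rw [hren, ExpPoly.toAmplitude_apply]
    refine ⟨mem_regularSeries_iff.1 ?_, hP _⟩
    rw [ExpPoly.evalLog_eq_pairing]
    exact (main T).2.pairing_mem _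
  · rw [hbog]
    -- The derivative pairs with `-X exp(-LX/2)/2`, a multiple of `X`, so the possibly singular
    -- zeroth moment does not enter.
    exact ⟨_, ExpPoly.hasLogDeriv_toAmplitude μ2 _, fun q2 => exists_hasLimitAtZero_iff.2
      (pairing_X_mul_bogoliubovPoly_mem hdeg (fun t _ => (main t).2) _)⟩
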